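/- Let $X>0$ and $\delta_0>0$. For $0<\delta<\delta_0$ let $u(x,t)=U_\delta(x-c_\delta t)$, with $U_\delta$ real-valued and $X$-periodic ($X$ independent of $\delta$), be a travelling wave of the KdV-KS equation $u_t+uu_x+u_{xxx}+\delta(u_{xx}+u_{xxxx})=0$, so that $(U_\delta-c_\delta)U_\delta'+U_\delta'''+\delta(U_\delta''+U_\delta'''')=0$. Suppose that this family continues an $X$-periodic travelling wave $(U_0,c_0)$ of the KdV equation $u_t+uu_x+u_{xxx}=0$ in the sense that $$U_\delta=U_0+\delta U_1+O(\delta^2)\ \text{ uniformly on }\mathbb R,\qquad c_\delta=c_0+\delta c_1+O(\delta^2).$$ Let $Lv=-((U_\delta-c_\delta)v)'-v'''-\delta(v''+v'''')$, let $L_\xi=e^{-i\xi\cdot}\,L\,e^{i\xi\cdot}$ be the Bloch operators on $L^2_{\rm per}(0,X)$ with domain $H^4_{\rm per}(0,X)$, and let $$E(\lambda,\xi,\delta)=\det\bigl(R(X,\lambda,\delta)-e^{i\xi X}\mathrm{Id}_{\mathbb C^4}\bigr)$$ be the periodic Evans function, where $R(\cdot,\lambda,\delta)$, $R(0,\lambda,\delta)=\mathrm{Id}$,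 is the resolvent matrix of $Lv=\lambda v$ written as a first-order system for $(v,v',v'',v''')$. Let $E_{kdv}(\lambda,\xi)=\det\bigl(R_{kdv}(X,\lambda)-e^{i\xi X}\mathrm{Id}_{\mathbb C^3}\bigr)$ be the corresponding function for the linearized KdV problem $-((U_0-c_0)v)'-v'''=\lambda v$, written as a first-order system for $(v,v',v'')$, whose Bloch operators have domain $H^3_{\rm per}(0,X)$. (1) There are a function $E_1(\lambda,\xi)$ and a nowhere vanishing factor $\Gamma(\lambda,\xi,\delta)$, real-analytic in $(\lambda,\xi,\delta)\in\mathbb C\times\mathbb R\times(0,\infty)$ and entire in $\lambda$, such that for every compact $K\subset\mathbb C$, as $\delta\to0^+$, $$E(\lambda,\xi,\delta)=\Gamma(\lambda,\xi,\delta)\,\bigl(E_{kdv}(\lambda,\xi)+\delta E_1(\lambda,\xi)+O(\delta^2)\bigr)$$ uniformly for $\lambda\in K$ and $\xi\in\mathbb R$. (2) Let $K\subset\mathbb C$ be compact and $\xi\in[-\pi/X,\pi/X)$. For every $\varepsilon>0$ there is $\delta_1>0$ such that for $0<\delta<\delta_1$ every eigenvalue of $L_\xi$ in $K$ is within $\varepsilon$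 of an eigenvalue in $K$ of the Bloch operator of linearized KdV with the same $\xi$. Moreover, if $\delta\mapsto\lambda_\delta\in K$ is continuous on some interval $(0,\delta_1)$ and $\lambda_\delta$ is an eigenvalue of $L_\xi$ for each such $\delta$, then $\lambda_\delta$ converges, as $\delta\to0^+$, to an eigenvalue $\lambda_0\in K$ of the Bloch operator of linearized KdV with the same $\xi$. -/

import Mathlib

/-! ### Resolvent matrices of linear systems `Y' = A Y` -/

/-- `R` is the resolvent (fundamental) matrix of `Y' = A(x) Y` normalised by `R(0) = Id`. -/
def IsResolventMatrix {n : ℕ} (A R : ℝ → Matrix (Fin n) (Fin n) ℂ) : Prop :=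
  R 0 = 1 ∧ ∀ (i j : Fin n) (x : ℝ), HasDerivAt (fun y => R y i j) ((A x * R x) i j) x

/-- The resolvent matrix of `Y' = A(x) Y`; it exists and is unique for continuous `A`, see
`isResolventMatrix_resolventMatrix` and `IsResolventMatrix.eq_resolventMatrix`. -/
noncomputable def resolventMatrix {n : ℕ} (A : ℝ → Matrix (Fin n) (Fin n) ℂ) :
    ℝ → Matrix (Fin n) (Fin n) ℂ :=
  Classical.epsilon (IsResolventMatrix A)

section ResolventExistence

/-- Picard iterates of `R' = A R`, `R(0) = 1`. -/
noncomputable def picardTerm {B : Type*} [NormedRing B] [NormedAlgebra ℝ B] (A : ℝ → B) :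
    ℕ → ℝ → B
  | 0 => fun _ => 1
  | k + 1 => fun x => ∫ t in (0 : ℝ)..x, A t * picardTerm A k t

theorem continuous_picardTerm {B : Type*} [NormedRing B] [NormedAlgebra ℝ B] [CompleteSpace B]
    {A : ℝ → B} (hA : Continuous A) (k : ℕ) : Continuous (picardTerm A k) := by
  induction k with
  | zero => exact continuous_const
  | succ k ih =>
    exact intervalIntegral.continuous_primitive
      (fun a b => (hA.mul ih).intervalIntegrable a b) 0

theorem hasDerivAt_picardTerm {B : Type*} [NormedRing B] [NormedAlgebra ℝ B] [CompleteSpace B]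
    {A : ℝ → B} (hA : Continuous A) (k : ℕ) (x : ℝ) :
    HasDerivAt (picardTerm A (k + 1)) (A x * picardTerm A k x) x := by
  have hc := hA.mul (continuous_picardTerm hA k)
  exact intervalIntegral.integral_hasDerivAt_right (hc.intervalIntegrable 0 x)
    (hc.stronglyMeasurableAtFilter _ _) hc.continuousAt

theorem norm_picardTerm_le {B : Type*} [NormedRing B] [NormedAlgebra ℝ B] [CompleteSpace B]
    {A : ℝ → B} {r M : ℝ} (hM : 0 ≤ M)
    (hb : ∀ x, |x| ≤ r → ‖A x‖ ≤ M) (k : ℕ) :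
    ∀ x, |x| ≤ r → ‖picardTerm A k x‖ ≤ ‖(1 : B)‖ * ((M * |x|) ^ k / k.factorial) := by
  induction k with
  | zero => intro x _; simp [picardTerm]
  | succ k ih =>
    intro x hx
    have key : ∀ t ∈ Set.uIoc 0 x, ‖A t * picardTerm A k t‖
        ≤ ‖(1 : B)‖ * (M ^ (k + 1) / k.factorial) * |t| ^ k := by
      intro t ht
      have ht' : |t| ≤ r := by
        refine le_trans ?_ hx
        rcases le_total 0 x with h | h
        · rw [Set.uIoc_of_le h] at ht
          rw [abs_of_pos ht.1, abs_of_nonneg h]; exact ht.2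
        · rw [Set.uIoc_of_ge h] at ht
          rw [abs_of_nonpos ht.2, abs_of_nonpos h]; linarith [ht.1]
      calc ‖A t * picardTerm A k t‖ ≤ ‖A t‖ * ‖picardTerm A k t‖ := norm_mul_le _ _
        _ ≤ M * (‖(1 : B)‖ * ((M * |t|) ^ k / k.factorial)) :=
            mul_le_mul (hb t ht') (ih t ht') (norm_nonneg _) hM
        _ = _ := by rw [mul_pow]; ring
    have hint : |∫ t in (0 : ℝ)..x, |t| ^ k| = |x| ^ (k + 1) / (k + 1) := by
      rcases le_total 0 x with h | h
      · have : ∫ t in (0 : ℝ)..x, |t| ^ k = ∫ t in (0 : ℝ)..x, t ^ k := by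
          refine intervalIntegral.integral_congr fun t ht => ?_
          rw [Set.uIcc_of_le h] at ht
          simp only [abs_of_nonneg ht.1]
        rw [this, integral_pow, abs_div, abs_of_pos (by positivity : (0 : ℝ) < (k : ℝ) + 1)]
        simp
      · have : ∫ t in (0 : ℝ)..x, |t| ^ k = ∫ t in (0 : ℝ)..x, (-1) ^ k * t ^ k := by
          refine intervalIntegral.integral_congr fun t ht => ?_
          rw [Set.uIcc_of_ge h] at ht
          simp only [abs_of_nonpos ht.2, neg_pow t]
        rw [this, intervalIntegral.integral_const_mul, integral_pow, abs_mul, abs_pow, abs_div,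
          abs_of_pos (by positivity : (0 : ℝ) < (k : ℝ) + 1)]
        simp
    calc ‖picardTerm A (k + 1) x‖
        ≤ |∫ t in (0 : ℝ)..x, ‖(1 : B)‖ * (M ^ (k + 1) / k.factorial) * |t| ^ k| := by
          refine intervalIntegral.norm_integral_le_abs_of_norm_le
            (MeasureTheory.ae_restrict_of_forall_mem measurableSet_uIoc key)
            (Continuous.intervalIntegrable (by fun_prop) _ _)
      _ = ‖(1 : B)‖ * ((M * |x|) ^ (k + 1) / (k + 1).factorial) := by
          rw [intervalIntegral.integral_const_mul, abs_mul, hint, abs_of_nonneg (by positivity),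
            Nat.factorial_succ, mul_pow]
          push_cast
          field_simp

theorem exists_resolvent_of_continuous {B : Type*} [NormedRing B] [NormedAlgebra ℝ B]
    [CompleteSpace B] {A : ℝ → B} (hA : Continuous A) :
    ∃ R : ℝ → B, R 0 = 1 ∧ ∀ x, HasDerivAt R (A x * R x) x := by
  have h0 : ∀ k, picardTerm A (k + 1) 0 = 0 := fun k => by simp [picardTerm]
  have hbd : ∀ r : ℝ, ∃ M, 0 ≤ M ∧ ∀ x, |x| ≤ r → ‖A x‖ ≤ M := by
    intro r
    obtain ⟨M, hM⟩ := (isCompact_Icc (a := -r) (b := r)).exists_bound_of_continuousOn hA.continuousOn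
    exact ⟨max M 0, le_max_right _ _, fun x hx => (hM x (abs_le.mp hx)).trans (le_max_left _ _)⟩
  have hsum : ∀ x, Summable fun k => picardTerm A k x := by
    intro x
    obtain ⟨M, hM, hb⟩ := hbd |x|
    exact Summable.of_norm_bounded ((Real.summable_pow_div_factorial (M * |x|)).mul_left ‖(1 : B)‖)
      fun k => norm_picardTerm_le hM hb k x le_rfl
  refine ⟨fun x => 1 + ∑' k, picardTerm A (k + 1) x, by simp [h0], fun x => ?_⟩
  have hx1 : (1 : B) + ∑' k, picardTerm A (k + 1) x = ∑' k, picardTerm A k x :=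
    ((hsum x).tsum_eq_zero_add).symm
  simp only [hx1]
  obtain ⟨M, hM, hb⟩ := hbd (|x| + 1)
  have hd := hasDerivAt_tsum_of_isPreconnected
    (g := fun k => picardTerm A (k + 1)) (g' := fun k y => A y * picardTerm A k y)
    (u := fun k : ℕ => M * (‖(1 : B)‖ * ((M * (|x| + 1)) ^ k / k.factorial)))
    (t := Metric.ball (0 : ℝ) (|x| + 1)) (y₀ := 0) (y := x)
    (((Real.summable_pow_div_factorial (M * (|x| + 1))).mul_left ‖(1 : B)‖).mul_left M)
    Metric.isOpen_ball (convex_ball _ _).isPreconnected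
    (fun k y _ => hasDerivAt_picardTerm hA k y)
    (fun k y hy => by
      have hy' : |y| ≤ |x| + 1 := by simpa using (Metric.mem_ball.mp hy).le
      refine (norm_mul_le _ _).trans (mul_le_mul (hb y hy') ?_ (norm_nonneg _) hM)
      refine (norm_picardTerm_le hM hb k y hy').trans ?_
      gcongr)
    (by simp; positivity) (by simp [h0]) (by simp)
  rw [(hsum x).tsum_mul_left] at hd
  exact hd.const_add 1

attribute [local instance] Matrix.linftyOpNormedAddCommGroup Matrix.linftyOpNormedSpace
  Matrix.linftyOpNormedRing Matrix.linftyOpNormedAlgebra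

theorem exists_isResolventMatrix {n : ℕ} {A : ℝ → Matrix (Fin n) (Fin n) ℂ}
    (hA : ∀ i j, Continuous fun x => A x i j) : ∃ R, IsResolventMatrix A R := by
  have hA' : Continuous A := continuous_matrix hA
  obtain ⟨R, hR0, hR⟩ := exists_resolvent_of_continuous hA'
  refine ⟨R, hR0, fun i j x => ?_⟩
  exact ((Matrix.entryLinearMap ℝ ℂ i j).toContinuousLinearMap.hasFDerivAt.comp_hasDerivAt x (hR x))

theorem isResolventMatrix_resolventMatrix {n : ℕ} {A : ℝ → Matrix (Fin n) (Fin n) ℂ}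
    (hA : ∀ i j, Continuous fun x => A x i j) : IsResolventMatrix A (resolventMatrix A) :=
  Classical.epsilon_spec (exists_isResolventMatrix hA)

theorem IsResolventMatrix.eq_resolventMatrix {n : ℕ} {A R : ℝ → Matrix (Fin n) (Fin n) ℂ}
    (hA : ∀ i j, Continuous fun x => A x i j) (hR : IsResolventMatrix A R) :
    R = resolventMatrix A := by
  have hA' : Continuous A := continuous_matrix hA
  have hd : ∀ S : ℝ → Matrix (Fin n) (Fin n) ℂ, IsResolventMatrix A S →
      ∀ x, HasDerivAt S (A x * S x) x := by
    intro S hS x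
    have h : HasDerivAt (fun y => ∑ i, ∑ j, S y i j • Matrix.single i j (1 : ℂ))
        (∑ i, ∑ j, (A x * S x) i j • Matrix.single i j (1 : ℂ)) x :=
      HasDerivAt.fun_sum fun i _ => HasDerivAt.fun_sum fun j _ => (hS.2 i j x).smul_const _
    have e : ∀ M : Matrix (Fin n) (Fin n) ℂ,
        ∑ i, ∑ j, M i j • Matrix.single i j (1 : ℂ) = M := fun M => by
      simpa [Matrix.smul_single] using (Matrix.matrix_eq_sum_single M).symm
    simpa only [e] using h
  have hS := isResolventMatrix_resolventMatrix hA
  funext x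
  obtain ⟨M, hM⟩ := (isCompact_Icc (a := -(|x| + 1)) (b := |x| + 1)).exists_bound_of_continuousOn
    hA'.continuousOn
  refine ODE_solution_unique_of_mem_Ioo (v := fun t Y => A t * Y) (s := fun _ => Set.univ)
    (K := Real.toNNReal M) (a := -(|x| + 1)) (b := |x| + 1) (t₀ := 0)
    (fun t ht => LipschitzWith.lipschitzOnWith (LipschitzWith.of_dist_le_mul fun Y Z => ?_))
    (by constructor <;> linarith [abs_nonneg x])
    (fun t _ => ⟨hd R hR t, trivial⟩) (fun t _ => ⟨hd _ hS t, trivial⟩) (hR.1.trans hS.1.symm)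
    (by constructor <;> linarith [neg_abs_le x, le_abs_self x])
  rw [dist_eq_norm, dist_eq_norm, ← mul_sub]
  refine (norm_mul_le _ _).trans (mul_le_mul_of_nonneg_right ?_ (norm_nonneg _))
  exact (hM t ⟨ht.1.le, ht.2.le⟩).trans (Real.le_coe_toNNReal M)

end ResolventExistence

/-! ### Periodic travelling waves

`u(x,t) = U(x - c t)` solves `u_t + u u_x + u_xxx + δ (u_xx + u_xxxx) = 0`. -/

/-- `U` is the profile of an `X`-periodic travelling wave with speed `c` of the KdV-KS equation. -/
def IsKdVKSWave (δ c X : ℝ) (U : ℝ → ℝ) : Prop :=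
  ContDiff ℝ 4 U ∧ Function.Periodic U X ∧
    ∀ x, (U x - c) * deriv U x + iteratedDeriv 3 U x
      + δ * (iteratedDeriv 2 U x + iteratedDeriv 4 U x) = 0

/-- `U` is the profile of an `X`-periodic travelling wave with speed `c` of the KdV equation. -/
def IsKdVWave (c X : ℝ) (U : ℝ → ℝ) : Prop :=
  ContDiff ℝ 3 U ∧ Function.Periodic U X ∧
    ∀ x, (U x - c) * deriv U x + iteratedDeriv 3 U x = 0

/-! ### Linearized operators, Bloch operators and their eigenvalues -/

/-- `L v = -((U - c) v)' - v''' - δ (v'' + v'''')`. For `δ = 0` this is the linearized KdV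
operator. -/
noncomputable def linearizedOp (δ c : ℝ) (U : ℝ → ℝ) (v : ℝ → ℂ) (x : ℝ) : ℂ :=
  -deriv (fun y => ((U y - c : ℝ) : ℂ) * v y) x - iteratedDeriv 3 v x
    - (δ : ℂ) * (iteratedDeriv 2 v x + iteratedDeriv 4 v x)

/-- The Bloch operator `(L_ξ w)(x) = e^{-iξx} L[e^{iξ·} w](x)`. -/
noncomputable def blochOp (δ c : ℝ) (U : ℝ → ℝ) (ξ : ℝ) (w : ℝ → ℂ) (x : ℝ) : ℂ :=
  Complex.exp (-(Complex.I * ξ * x))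
    * linearizedOp δ c U (fun y => Complex.exp (Complex.I * ξ * y) * w y) x

/-- `w` is (the continuous representative of) an element of the Sobolev space `H^{m+1}_per(0,X)`:
it is `X`-periodic, of class `C^m`, and its `m`-th derivative is the primitive of a function that
is square integrable over a period. -/
def MemHSuccPer (m : ℕ) (X : ℝ) (w : ℝ → ℂ) : Prop :=
  Function.Periodic w X ∧ ContDiff ℝ m w ∧
    ∃ g : ℝ → ℂ, MeasureTheory.MemLp g 2 (MeasureTheory.volume.restrict (Set.Ioc 0 X)) ∧
      ∀ x ∈ Set.Icc 0 X, iteratedDeriv m w x = iteratedDeriv m w 0 + ∫ t in (0 : ℝ)..x, g t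

/-- `lam` is an eigenvalue of the Bloch operator `L_ξ` of the KdV-KS equation, an operator on
`L²_per(0,X)` with domain `H⁴_per(0,X)`. -/
def IsKdVKSBlochEigenvalue (δ c X : ℝ) (U : ℝ → ℝ) (ξ : ℝ) (lam : ℂ) : Prop :=
  ∃ w : ℝ → ℂ, MemHSuccPer 3 X w ∧ w ≠ 0 ∧ ∀ᵐ x : ℝ, blochOp δ c U ξ w x = lam * w x

/-- `lam` is an eigenvalue of the Bloch operator with Floquet exponent `ξ` of the linearized KdV
equation, an operator on `L²_per(0,X)` with domain `H³_per(0,X)`. -/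
def IsKdVBlochEigenvalue (c X : ℝ) (U : ℝ → ℝ) (ξ : ℝ) (lam : ℂ) : Prop :=
  ∃ w : ℝ → ℂ, MemHSuccPer 2 X w ∧ w ≠ 0 ∧ ∀ᵐ x : ℝ, blochOp 0 c U ξ w x = lam * w x

/-! ### Evans functions -/

/-- Coefficient matrix of `L v = lam v` as a first order system for `(v, v', v'', v''')`. -/
noncomputable def kdvksMatrix (δ c : ℝ) (U : ℝ → ℝ) (lam : ℂ) (x : ℝ) :
    Matrix (Fin 4) (Fin 4) ℂ :=
  !![0, 1, 0, 0;
     0, 0, 1, 0;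
     0, 0, 0, 1;
     -(((deriv U x : ℝ) : ℂ) + lam) / δ, -((U x : ℂ) - c) / δ, -1, -1 / δ]

/-- Coefficient matrix of the linearized KdV spectral problem `-((U - c) v)' - v''' = lam v` as a
first order system for `(v, v', v'')`. -/
noncomputable def kdvMatrix (c : ℝ) (U : ℝ → ℝ) (lam : ℂ) (x : ℝ) :
    Matrix (Fin 3) (Fin 3) ℂ :=
  !![0, 1, 0;
     0, 0, 1;
     -(((deriv U x : ℝ) : ℂ) + lam), -((U x : ℂ) - c), 0]

/-- Periodic Evans function `det (R(X, lam, δ) - e^{iξX} Id)` of `L v = lam v`. -/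
noncomputable def evansKdVKS (δ c X : ℝ) (U : ℝ → ℝ) (lam : ℂ) (ξ : ℝ) : ℂ :=
  (resolventMatrix (kdvksMatrix δ c U lam) X
    - Complex.exp (Complex.I * ξ * X) • (1 : Matrix (Fin 4) (Fin 4) ℂ)).det

/-- Periodic Evans function `det (R_kdv(X, lam) - e^{iξX} Id)` of the linearized KdV equation. -/
noncomputable def evansKdV (c X : ℝ) (U : ℝ → ℝ) (lam : ℂ) (ξ : ℝ) : ℂ :=
  (resolventMatrix (kdvMatrix c U lam) X
    - Complex.exp (Complex.I * ξ * X) • (1 : Matrix (Fin 3) (Fin 3) ℂ)).det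

/-! ### Linear systems of ordinary differential equations -/

section LinearSystems

variable {n : ℕ}

/-! In the unknowns (v, v', v'', v''') the KdV-KS spectral problem is singular as δ → 0: the last
row of its matrix is divided by δ. Put a = U_δ - c_δ, s = (v + δ v', v' + δ v'', v'' + a v + δ (v' +
v''')) and p = v'. The problem becomes s' = A(x) s + δ p β(x), δ p' = s₂ - p, that is, three slow
unknowns that obey the KdV system up to O(δ) and one fast unknown that relaxes to s₂ at rate 1/δ.
This change of unknowns is X-periodic with determinant δ², so it conjugates the monodromy matrices
and leaves the Evans function unchanged (`evansKdVKS_eq`; `evansKdV_eq` is the KdV analogue). It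
also removes U_δ' from the coefficients, which is why an expansion of U_δ in the uniform norm is
enough.

The monodromy matrix of the new system has slow block T₀ + δ N + O(δ²), last column O(δ²) and
bounded last row (`exists_monodromy_expansion`). Here T₀ is the KdV monodromy matrix and N solves
the first variational equation, in which p is replaced by its limit s₂. The last column is small
because the initial layer exp(-x/δ) has length δ and acts on s through a further factor δ. With μ =
exp(iξX), the determinant of the monodromy matrix minus μ is therefore -μ det(T₀ + δ N - μ) + O(δ²).
This gives Γ = -μ and, by Jacobi's formula, E₁ = tr(adj(T₀ - μ) N) (`exists_evans_expansion`).

For the eigenvalues, every Bloch eigenvalue of KdV-KS is a zero of E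
(`evansKdVKS_eq_zero_of_isKdVKSBlochEigenvalue`), so E_kdv is O(δ) there, and every zero of E_kdv is
a Bloch eigenvalue of KdV (`isKdVBlochEigenvalue_of_evansKdV_eq_zero`). Closeness to the limiting
eigenvalues is then compactness (`exists_zero_near_of_norm_lt`). For a continuous branch, E_kdv(·,
ξ) is entire and, by an energy identity (`evansKdV_ne_zero`), not identically zero. Its zeros are
thus isolated, and a branch along which E_kdv tends to 0 cannot cross a small circle around a zero
(`exists_tendsto_zero_of_tendsto`). -/

theorem hasDerivWithinAt_matrix_mul_apply {l m k : Type*} [Fintype m]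
    {P P' : ℝ → Matrix l m ℂ} {Q Q' : ℝ → Matrix m k ℂ} {s : Set ℝ} {x : ℝ}
    (hP : ∀ i j, HasDerivWithinAt (fun y => P y i j) (P' x i j) s x)
    (hQ : ∀ i j, HasDerivWithinAt (fun y => Q y i j) (Q' x i j) s x) (i : l) (j : k) :
    HasDerivWithinAt (fun y => (P y * Q y) i j) ((P' x * Q x + P x * Q' x) i j) s x := by
  simp only [Matrix.add_apply, Matrix.mul_apply, ← Finset.sum_add_distrib]
  exact HasDerivWithinAt.fun_sum fun r _ => (hP i r).mul (hQ r j)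

theorem hasDerivAt_matrix_mul_apply {l m k : Type*} [Fintype m]
    {P P' : ℝ → Matrix l m ℂ} {Q Q' : ℝ → Matrix m k ℂ} {x : ℝ}
    (hP : ∀ i j, HasDerivAt (fun y => P y i j) (P' x i j) x)
    (hQ : ∀ i j, HasDerivAt (fun y => Q y i j) (Q' x i j) x) (i : l) (j : k) :
    HasDerivAt (fun y => (P y * Q y) i j) ((P' x * Q x + P x * Q' x) i j) x := by
  simp only [← hasDerivWithinAt_univ] at *
  exact hasDerivWithinAt_matrix_mul_apply hP hQ i j

theorem matrix_eq_of_hasDerivAt_zero {l k : Type*} {F : ℝ → Matrix l k ℂ}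
    (hF : ∀ i j x, HasDerivAt (fun y => F y i j) 0 x) (x y : ℝ) : F x = F y := by
  ext i j
  exact is_const_of_deriv_eq_zero (f := fun y => F y i j)
    (fun x => (hF i j x).differentiableAt) (fun x => (hF i j x).deriv) x y

/-- The resolvent matrix is invertible, and its inverse solves the adjoint system. -/
theorem IsResolventMatrix.exists_inverse {A R : ℝ → Matrix (Fin n) (Fin n) ℂ}
    (hA : ∀ i j, Continuous fun x => A x i j) (hR : IsResolventMatrix A R) :
    ∃ S : ℝ → Matrix (Fin n) (Fin n) ℂ, S 0 = 1 ∧ (∀ x, S x * R x = 1) ∧ (∀ x, R x * S x = 1) ∧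
      ∀ i j x, HasDerivAt (fun y => S y i j) ((-(S x * A x)) i j) x := by
  -- The transpose of a solution of T' = -Aᵀ T solves S' = -S A, so S R has zero derivative and
  -- keeps its initial value 1.
  obtain ⟨T, hT0, hT⟩ := exists_isResolventMatrix (A := fun x => -(A x).transpose)
    (fun i j => (hA j i).neg)
  have hS : ∀ i j x, HasDerivAt (fun y => (T y).transpose i j)
      ((-((T x).transpose * A x)) i j) x := by
    intro i j x
    have := hT j i x
    have e : (-(A x).transpose * T x) j i = (-((T x).transpose * A x)) i j := by
      rw [← Matrix.transpose_apply (-(A x).transpose * T x), Matrix.transpose_mul,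
        Matrix.transpose_neg, Matrix.transpose_transpose, Matrix.mul_neg]
    rw [← e]; exact this
  have h1 : ∀ x, (T x).transpose * R x = 1 := by
    intro x
    have := matrix_eq_of_hasDerivAt_zero (F := fun x => (T x).transpose * R x) (fun i j x => by
      have := hasDerivAt_matrix_mul_apply (P := fun y => (T y).transpose)
        (P' := fun x => -((T x).transpose * A x)) (Q := R) (Q' := fun x => A x * R x) (x := x)
        (fun i j => hS i j x) (fun i j => hR.2 i j x) i j
      simpa [Matrix.neg_mul, Matrix.mul_assoc] using this) x 0
    simpa [hT0, hR.1] using this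
  exact ⟨fun x => (T x).transpose, by simp [hT0], h1, fun x => mul_eq_one_comm.mp (h1 x), hS⟩

theorem hasDerivWithinAt_mulVec_apply {P P' : ℝ → Matrix (Fin n) (Fin n) ℂ}
    {Z Z' : ℝ → Fin n → ℂ} {s : Set ℝ} {x : ℝ}
    (hP : ∀ i j, HasDerivWithinAt (fun y => P y i j) (P' x i j) s x)
    (hZ : ∀ i, HasDerivWithinAt (fun y => Z y i) (Z' x i) s x) (i : Fin n) :
    HasDerivWithinAt (fun y => (P y).mulVec (Z y) i)
      ((P' x).mulVec (Z x) i + (P x).mulVec (Z' x) i) s x := by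
  simp only [Matrix.mulVec, dotProduct, ← Finset.sum_add_distrib]
  exact HasDerivWithinAt.fun_sum fun r _ => (hP i r).mul (hZ r)

/-- The product R⁻¹ Z has zero right derivative and is continuous, hence constant. One-sided
derivatives on a single period are all that an H⁴ eigenfunction will provide. -/
theorem IsResolventMatrix.eq_mulVec {A R : ℝ → Matrix (Fin n) (Fin n) ℂ}
    (hA : ∀ i j, Continuous fun x => A x i j) (hR : IsResolventMatrix A R)
    {Z : ℝ → Fin n → ℂ} {X : ℝ} (hc : ∀ i, ContinuousOn (fun y => Z y i) (Set.Icc 0 X))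
    (hZ : ∀ i, ∀ x ∈ Set.Ico 0 X,
      HasDerivWithinAt (fun y => Z y i) ((A x).mulVec (Z x) i) (Set.Ici x) x)
    {x : ℝ} (hx : x ∈ Set.Icc 0 X) : Z x = (R x).mulVec (Z 0) := by
  obtain ⟨S, hS0, hSR, hRS, hS⟩ := hR.exists_inverse hA
  have key : (S x).mulVec (Z x) = Z 0 := by
    funext i
    have := constant_of_has_deriv_right_zero (f := fun y => (S y).mulVec (Z y) i) (a := 0) (b := X)
      (by
        simp only [Matrix.mulVec, dotProduct]
        exact continuousOn_finsetSum _ fun r _ =>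
          (ContinuousOn.mul (fun y _ => (hS i r y).continuousAt.continuousWithinAt) (hc r)))
      (fun y hy => by
        have := hasDerivWithinAt_mulVec_apply (P := S) (P' := fun x => -(S x * A x)) (Z := Z)
          (Z' := fun x => (A x).mulVec (Z x)) (s := Set.Ici y) (x := y)
          (fun i j => (hS i j y).hasDerivWithinAt) (fun i => hZ i y hy) i
        simpa [Matrix.neg_mulVec, Matrix.mulVec_mulVec] using this) x hx
    simpa [hS0] using this
  rw [← key, Matrix.mulVec_mulVec, hRS, Matrix.one_mulVec]

theorem IsResolventMatrix.eq_mulVec_of_hasDerivAt {A R : ℝ → Matrix (Fin n) (Fin n) ℂ}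
    (hA : ∀ i j, Continuous fun x => A x i j) (hR : IsResolventMatrix A R) {Z : ℝ → Fin n → ℂ}
    (hZ : ∀ i x, HasDerivAt (fun y => Z y i) ((A x).mulVec (Z x) i) x) (x : ℝ) :
    Z x = (R x).mulVec (Z 0) := by
  obtain ⟨S, hS0, hSR, hRS, hS⟩ := hR.exists_inverse hA
  have hd : ∀ i y, HasDerivAt (fun y => (S y).mulVec (Z y) i) 0 y := by
    intro i y
    have := hasDerivWithinAt_mulVec_apply (P := S) (P' := fun x => -(S x * A x)) (Z := Z)
      (Z' := fun x => (A x).mulVec (Z x)) (s := Set.univ) (x := y)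
      (fun i j => (hS i j y).hasDerivWithinAt) (fun i => (hZ i y).hasDerivWithinAt) i
    simpa [Matrix.neg_mulVec, Matrix.mulVec_mulVec] using this
  have key : (S x).mulVec (Z x) = Z 0 := by
    funext i
    have := is_const_of_deriv_eq_zero (f := fun y => (S y).mulVec (Z y) i)
      (fun x => (hd i x).differentiableAt) (fun x => (hd i x).deriv) x 0
    simpa [hS0] using this
  rw [← key, Matrix.mulVec_mulVec, hRS, Matrix.one_mulVec]

theorem IsResolventMatrix.hasDerivAt_mulVec {A R : ℝ → Matrix (Fin n) (Fin n) ℂ}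
    (hR : IsResolventMatrix A R) (z : Fin n → ℂ) (i : Fin n) (x : ℝ) :
    HasDerivAt (fun y => (R y).mulVec z i) ((A x).mulVec ((R x).mulVec z) i) x := by
  have := hasDerivWithinAt_mulVec_apply (P := R) (P' := fun x => A x * R x) (Z := fun _ => z)
    (Z' := fun _ => 0) (s := Set.univ) (x := x) (fun i j => (hR.2 i j x).hasDerivWithinAt)
    (fun i => hasDerivWithinAt_const _ _ _) i
  simpa [Matrix.mulVec_mulVec] using this

theorem IsResolventMatrix.continuous_apply {A R : ℝ → Matrix (Fin n) (Fin n) ℂ}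
    (hR : IsResolventMatrix A R) (i j : Fin n) : Continuous fun x => R x i j :=
  continuous_iff_continuousAt.mpr fun x => (hR.2 i j x).continuousAt

/-- Solutions of a periodic system starting at an eigenvector of the monodromy matrix are Bloch
waves. -/
theorem IsResolventMatrix.mulVec_add_period {A R : ℝ → Matrix (Fin n) (Fin n) ℂ}
    (hA : ∀ i j, Continuous fun x => A x i j) (hR : IsResolventMatrix A R) {X : ℝ}
    (hper : Function.Periodic A X) {μ : ℂ} {z : Fin n → ℂ} (hz : (R X).mulVec z = μ • z) (x : ℝ) :
    (R (x + X)).mulVec z = μ • (R x).mulVec z := by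
  have := hR.eq_mulVec_of_hasDerivAt hA (Z := fun x => (R (x + X)).mulVec z) (fun i x => by
    have := (hR.hasDerivAt_mulVec z i (x + X)).comp_add_const x X
    rwa [hper x] at this) x
  simp only [zero_add, hz, Matrix.mulVec_smul] at this
  exact this

/-- The inhomogeneous system `N' = A N + G`, `N(0) = 0`, is solvable. -/
theorem exists_inhomogeneous_solution {A G : ℝ → Matrix (Fin n) (Fin n) ℂ}
    (hA : ∀ i j, Continuous fun x => A x i j) (hG : ∀ i j, Continuous fun x => G x i j) :
    ∃ N : ℝ → Matrix (Fin n) (Fin n) ℂ, N 0 = 0 ∧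
      ∀ i j x, HasDerivAt (fun y => N y i j) ((A x * N x + G x) i j) x := by
  have hR := isResolventMatrix_resolventMatrix hA
  obtain ⟨S, hS0, hSR, hRS, hS⟩ := hR.exists_inverse hA
  have hSc : ∀ i j, Continuous fun x => (S x * G x) i j := fun i j => by
    simp only [Matrix.mul_apply]
    exact continuous_finsetSum _ fun r _ =>
      (continuous_iff_continuousAt.mpr fun x => (hS i r x).continuousAt).mul (hG r j)
  let I : ℝ → Matrix (Fin n) (Fin n) ℂ := fun x => Matrix.of fun i j =>
    ∫ t in (0 : ℝ)..x, (S t * G t) i j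
  have hI : ∀ i j x, HasDerivAt (fun y => I y i j) ((S x * G x) i j) x := fun i j x =>
    intervalIntegral.integral_hasDerivAt_right ((hSc i j).intervalIntegrable 0 x)
      ((hSc i j).stronglyMeasurableAtFilter _ _) (hSc i j).continuousAt
  refine ⟨fun x => resolventMatrix A x * I x, ?_, fun i j x => ?_⟩
  · have : I 0 = 0 := by ext i j; simp [I]
    simp [this]
  · have := hasDerivAt_matrix_mul_apply (P := resolventMatrix A)
      (P' := fun x => A x * resolventMatrix A x) (Q := I) (Q' := fun x => S x * G x) (x := x)
      (fun i j => hR.2 i j x) (fun i j => hI i j x) i j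
    rwa [← Matrix.mul_assoc (resolventMatrix A x), hRS, Matrix.one_mul, Matrix.mul_assoc] at this

/-- A periodic change of unknowns does not change the characteristic polynomial of the monodromy
matrix. -/
theorem det_resolventMatrix_sub_eq_of_gauge {A B P P' : ℝ → Matrix (Fin n) (Fin n) ℂ} {X : ℝ}
    (hA : ∀ i j, Continuous fun x => A x i j) (hB : ∀ i j, Continuous fun x => B x i j)
    (hP : ∀ i j x, HasDerivAt (fun y => P y i j) (P' x i j) x)
    (hPAB : ∀ x, P' x + P x * A x = B x * P x) (hdet : IsUnit (P 0).det) (hPX : P X = P 0)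
    (μ : ℂ) :
    (resolventMatrix A X - μ • (1 : Matrix (Fin n) (Fin n) ℂ)).det
      = (resolventMatrix B X - μ • (1 : Matrix (Fin n) (Fin n) ℂ)).det := by
  have hR := isResolventMatrix_resolventMatrix hA
  have hT : IsResolventMatrix B (fun x => P x * resolventMatrix A x * (P 0)⁻¹) := by
    refine ⟨by simp [hR.1, Matrix.mul_nonsing_inv _ hdet], fun i j x => ?_⟩
    have h1 := fun i j => hasDerivAt_matrix_mul_apply (P := P) (P' := P')
      (Q := resolventMatrix A) (Q' := fun x => A x * resolventMatrix A x) (x := x)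
      (fun i j => hP i j x) (fun i j => hR.2 i j x) i j
    have h2 := hasDerivAt_matrix_mul_apply (P := fun y => P y * resolventMatrix A y)
      (P' := fun x => P' x * resolventMatrix A x + P x * (A x * resolventMatrix A x))
      (Q := fun _ => (P 0)⁻¹) (Q' := fun _ => 0) (x := x) h1
      (fun i j => hasDerivAt_const _ _) i j
    have e : P' x * resolventMatrix A x + P x * (A x * resolventMatrix A x)
        = B x * (P x * resolventMatrix A x) := by
      rw [← Matrix.mul_assoc, ← Matrix.add_mul, hPAB, Matrix.mul_assoc]
    rw [Matrix.mul_zero, add_zero, e, Matrix.mul_assoc] at h2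
    exact h2
  have hPX' : resolventMatrix B X - μ • (1 : Matrix (Fin n) (Fin n) ℂ)
      = P 0 * (resolventMatrix A X - μ • (1 : Matrix (Fin n) (Fin n) ℂ)) * (P 0)⁻¹ := by
    rw [← hT.eq_resolventMatrix hB]
    simp only [hPX, Matrix.mul_sub, Matrix.sub_mul, Matrix.mul_smul, Matrix.smul_mul,
      Matrix.mul_one, Matrix.mul_nonsing_inv _ hdet]
  rw [hPX', Matrix.det_conj ((Matrix.isUnit_iff_isUnit_det _).mpr hdet)]

end LinearSystems

/-! ### Integral inequalities and fast-slow systems -/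

section FastSlow

open Set

/-- Gronwall in integral form: multiplied by exp(-M x), the majorant C + M ∫ f is nonincreasing. -/
theorem le_mul_exp_of_le_add_mul_integral {f : ℝ → ℝ} (hf : Continuous f) {C M X : ℝ}
    (hM : 0 ≤ M) (h : ∀ x ∈ Icc 0 X, f x ≤ C + M * ∫ t in (0 : ℝ)..x, f t) {x : ℝ}
    (hx : x ∈ Icc 0 X) : f x ≤ C * Real.exp (M * x) := by
  let Φ : ℝ → ℝ := fun x => (C + M * ∫ t in (0 : ℝ)..x, f t) * Real.exp (-(M * x))
  have hd : ∀ x, HasDerivAt Φ ((M * f x) * Real.exp (-(M * x))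
      + (C + M * ∫ t in (0 : ℝ)..x, f t) * (Real.exp (-(M * x)) * -(M * 1))) x := fun x =>
    (((intervalIntegral.integral_hasDerivAt_right (hf.intervalIntegrable 0 x)
      (hf.stronglyMeasurableAtFilter _ _) hf.continuousAt).const_mul M).const_add C).mul
      (((hasDerivAt_id x).const_mul M).fun_neg.exp)
  have hanti : AntitoneOn Φ (Icc 0 X) := by
    refine antitoneOn_of_deriv_nonpos (convex_Icc 0 X)
      (fun y _ => (hd y).continuousAt.continuousWithinAt)
      (fun y _ => (hd y).differentiableAt.differentiableWithinAt) (fun y hy => ?_)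
    rw [interior_Icc] at hy
    have h1 := h y ⟨hy.1.le, hy.2.le⟩
    rw [(hd y).deriv]
    have : (M * f y) * Real.exp (-(M * y))
      + (C + M * ∫ t in (0 : ℝ)..y, f t) * (Real.exp (-(M * y)) * -(M * 1))
      = -(M * Real.exp (-(M * y)) * (C + M * (∫ t in (0 : ℝ)..y, f t) - f y)) := by ring
    rw [this]
    have : 0 ≤ M * Real.exp (-(M * y)) := by positivity
    nlinarith [mul_nonneg this (sub_nonneg.mpr h1)]
  have h0 : Φ x ≤ C := by
    have := hanti ⟨le_rfl, hx.1.trans hx.2⟩ hx hx.1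
    simpa [Φ] using this
  have hE : Real.exp (-(M * x)) * Real.exp (M * x) = 1 := by
    rw [← Real.exp_add]; simp
  calc f x ≤ C + M * ∫ t in (0 : ℝ)..x, f t := h x hx
    _ = Φ x * Real.exp (M * x) := by
      simp only [Φ]; rw [mul_assoc, hE, mul_one]
    _ ≤ C * Real.exp (M * x) := by gcongr

theorem norm_le_add_integral_of_norm_deriv_le {E : Type*} [NormedAddCommGroup E] [NormedSpace ℝ E]
    {D D' : ℝ → E} {φ : ℝ → ℝ} {X : ℝ} (hφ : Continuous φ)
    (hD : ∀ x, HasDerivAt D (D' x) x) (hb : ∀ x ∈ Icc 0 X, ‖D' x‖ ≤ φ x) {x : ℝ}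
    (hx : x ∈ Icc 0 X) : ‖D x‖ ≤ ‖D 0‖ + ∫ t in (0 : ℝ)..x, φ t :=
  image_norm_le_of_norm_deriv_right_le_deriv_boundary (a := 0) (b := X) (f' := D')
    (B := fun x => ‖D 0‖ + ∫ t in (0 : ℝ)..x, φ t) (B' := φ)
    (fun y _ => (hD y).continuousAt.continuousWithinAt)
    (fun y _ => (hD y).hasDerivWithinAt) (by simp)
    (fun y => (intervalIntegral.integral_hasDerivAt_right (hφ.intervalIntegrable 0 y)
      (hφ.stronglyMeasurableAtFilter _ _) hφ.continuousAt).const_add _)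
    (fun y hy => hb y ⟨hy.1, hy.2.le⟩) hx

/-- Gronwall's inequality with a forcing term controlled in `L¹`. -/
theorem norm_le_mul_exp_of_norm_deriv_le {E : Type*} [NormedAddCommGroup E] [NormedSpace ℝ E]
    {D D' : ℝ → E} {φ : ℝ → ℝ} {X M F : ℝ} (hφ : Continuous φ) (hM : 0 ≤ M)
    (hD : ∀ x, HasDerivAt D (D' x) x) (hb : ∀ x ∈ Icc 0 X, ‖D' x‖ ≤ M * ‖D x‖ + φ x)
    (hF : ∀ x ∈ Icc 0 X, ∫ t in (0 : ℝ)..x, φ t ≤ F) {x : ℝ}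
    (hx : x ∈ Icc 0 X) : ‖D x‖ ≤ (‖D 0‖ + F) * Real.exp (M * X) := by
  have hDc : Continuous D := continuous_iff_continuousAt.mpr fun x => (hD x).continuousAt
  have hF0 : 0 ≤ F := by simpa using hF 0 ⟨le_rfl, hx.1.trans hx.2⟩
  refine (le_mul_exp_of_le_add_mul_integral (f := fun x => ‖D x‖) hDc.norm hM
    (C := ‖D 0‖ + F) (fun y hy => ?_) hx).trans ?_
  · refine (norm_le_add_integral_of_norm_deriv_le (φ := fun x => M * ‖D x‖ + φ x) (by fun_prop)
      hD hb hy).trans ?_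
    rw [intervalIntegral.integral_add (Continuous.intervalIntegrable (by fun_prop) _ _)
      (hφ.intervalIntegrable _ _), intervalIntegral.integral_const_mul]
    linarith [hF y hy]
  · have := hx.2
    gcongr

/-! ### Scalar relaxation equations δ p' + p = g. -/

variable {δ : ℝ} {p p' : ℝ → ℂ}

theorem hasDerivAt_exp_div (δ x : ℝ) :
    HasDerivAt (fun x => Real.exp (x / δ)) (Real.exp (x / δ) * (1 / δ)) x :=
  ((hasDerivAt_id x).div_const δ).exp

theorem hasDerivAt_exp_smul (hp : ∀ x, HasDerivAt p (p' x) x) (hδ : 0 < δ) (x : ℝ) :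
    HasDerivAt (fun x => Real.exp (x / δ) • p x)
      ((Real.exp (x / δ) / δ) • (δ * p' x + p x)) x := by
  have h := (hasDerivAt_exp_div δ x).smul (hp x)
  refine h.congr_deriv ?_
  have : (δ : ℂ) ≠ 0 := by exact_mod_cast hδ.ne'
  simp only [Complex.real_smul]
  push_cast
  field_simp

/-- A fast variable relaxing to `g` is bounded by its decaying initial layer plus `sup ‖g‖`. -/
theorem norm_le_of_relaxation {C X : ℝ} (hδ : 0 < δ) (hp : ∀ x, HasDerivAt p (p' x) x)
    (hb : ∀ x ∈ Icc 0 X, ‖δ * p' x + p x‖ ≤ C) {x : ℝ} (hx : x ∈ Icc 0 X) :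
    ‖p x‖ ≤ Real.exp (-(x / δ)) * ‖p 0‖ + C := by
  have h := image_norm_le_of_norm_deriv_right_le_deriv_boundary (a := 0) (b := X)
    (f := fun x => Real.exp (x / δ) • p x)
    (f' := fun x => (Real.exp (x / δ) / δ) • (δ * p' x + p x))
    (B := fun x => ‖p 0‖ + C * (Real.exp (x / δ) - 1)) (B' := fun x => C * (Real.exp (x / δ) * (1 / δ)))
    (fun y _ => (hasDerivAt_exp_smul hp hδ y).continuousAt.continuousWithinAt)
    (fun y _ => (hasDerivAt_exp_smul hp hδ y).hasDerivWithinAt) (by simp)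
    (fun y => (((hasDerivAt_exp_div δ y).sub_const 1).const_mul C).const_add _)
    (fun y hy => by
      rw [norm_smul, Real.norm_of_nonneg (by positivity)]
      have := mul_le_mul_of_nonneg_left (hb y ⟨hy.1, hy.2.le⟩)
        (by positivity : 0 ≤ Real.exp (y / δ) / δ)
      exact this.trans_eq (by ring)) hx
  have hC : 0 ≤ C := (norm_nonneg _).trans (hb x hx)
  rw [norm_smul, Real.norm_of_nonneg (Real.exp_pos _).le] at h
  have hE : Real.exp (-(x / δ)) * Real.exp (x / δ) = 1 := by rw [← Real.exp_add]; simp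
  have h2 := mul_le_mul_of_nonneg_left h (Real.exp_pos (-(x / δ))).le
  rw [← mul_assoc, hE, one_mul] at h2
  refine h2.trans ?_
  have : Real.exp (-(x / δ)) * (‖p 0‖ + C * (Real.exp (x / δ) - 1))
    = Real.exp (-(x / δ)) * ‖p 0‖ + C * (Real.exp (-(x / δ)) * Real.exp (x / δ))
      - C * Real.exp (-(x / δ)) := by ring
  rw [this, hE]
  have := mul_nonneg hC (Real.exp_pos (-(x / δ))).le
  linarith

/-- `L¹` estimate for a fast variable relaxing to `g` with `‖g‖ ≤ γ`. -/
theorem integral_norm_le_of_relaxation {γ : ℝ → ℝ} {X : ℝ} (hδ : 0 < δ)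
    (hp : ∀ x, HasDerivAt p (p' x) x) (hγ : Continuous γ)
    (hb : ∀ x ∈ Icc 0 X, ‖δ * p' x + p x‖ ≤ γ x) {x : ℝ} (hx : x ∈ Icc 0 X) :
    ∫ t in (0 : ℝ)..x, ‖p t‖ ≤ δ * ‖p 0‖ + ∫ t in (0 : ℝ)..x, γ t := by
  have hpc : Continuous p := continuous_iff_continuousAt.mpr fun x => (hp x).continuousAt
  have hγ' : Continuous fun t => Real.exp (t / δ) / δ * γ t := by fun_prop
  -- The function ν = exp(-x/δ) Ψ solves the scalar equation δ ν' = γ - ν with ν(0) = ‖p 0‖ and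
  -- dominates ‖p‖. Integrating that equation gives ∫ ν = ∫ γ + δ (ν(0) - ν(x)), and the last term
  -- is dropped since ν ≥ 0.
  let Ψ : ℝ → ℝ := fun x => ‖p 0‖ + ∫ t in (0 : ℝ)..x, Real.exp (t / δ) / δ * γ t
  have hΨ : ∀ x, HasDerivAt Ψ (Real.exp (x / δ) / δ * γ x) x := fun x =>
    (intervalIntegral.integral_hasDerivAt_right (hγ'.intervalIntegrable 0 x)
      (hγ'.stronglyMeasurableAtFilter _ _) hγ'.continuousAt).const_add _
  let ν : ℝ → ℝ := fun x => Real.exp (-(x / δ)) * Ψ x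
  have hν : ∀ x, HasDerivAt ν ((γ x - ν x) / δ) x := by
    intro x
    have h := (((hasDerivAt_id x).div_const δ).fun_neg.exp).mul (hΨ x)
    refine h.congr_deriv ?_
    have hE : Real.exp (-(x / δ)) * Real.exp (x / δ) = 1 := by rw [← Real.exp_add]; simp
    simp only [ν, id]
    have : Real.exp (-(x / δ)) * (Real.exp (x / δ) / δ * γ x)
      = (Real.exp (-(x / δ)) * Real.exp (x / δ)) * (γ x / δ) := by ring
    rw [this, hE]; ring
  have hνc : Continuous ν := continuous_iff_continuousAt.mpr fun x => (hν x).continuousAt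
  have hle : ∀ y ∈ Icc 0 X, ‖p y‖ ≤ ν y := by
    intro y hy
    have h := norm_le_add_integral_of_norm_deriv_le (D := fun x => Real.exp (x / δ) • p x)
      hγ' (hasDerivAt_exp_smul hp hδ) (X := X) (fun z hz => by
        rw [norm_smul, Real.norm_of_nonneg (by positivity)]
        have := hb z hz
        gcongr) hy
    rw [norm_smul, Real.norm_of_nonneg (Real.exp_pos _).le] at h
    have hE : Real.exp (-(y / δ)) * Real.exp (y / δ) = 1 := by rw [← Real.exp_add]; simp
    have h2 := mul_le_mul_of_nonneg_left h (Real.exp_pos (-(y / δ))).le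
    rw [← mul_assoc, hE, one_mul] at h2
    simpa [ν, Ψ] using h2
  have hν0 : ν 0 = ‖p 0‖ := by simp [ν, Ψ]
  have hint : ∫ t in (0 : ℝ)..x, (γ t - ν t) / δ = ν x - ν 0 :=
    intervalIntegral.integral_eq_sub_of_hasDerivAt (fun t _ => hν t)
      (Continuous.intervalIntegrable (by fun_prop) _ _)
  rw [intervalIntegral.integral_div, intervalIntegral.integral_sub (hγ.intervalIntegrable _ _)
    (hνc.intervalIntegrable _ _), hν0, div_eq_iff hδ.ne'] at hint
  have hmono : ∫ t in (0 : ℝ)..x, ‖p t‖ ≤ ∫ t in (0 : ℝ)..x, ν t :=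
    intervalIntegral.integral_mono_on hx.1 (hpc.norm.intervalIntegrable _ _)
      (hνc.intervalIntegrable _ _) fun t ht => hle t ⟨ht.1, ht.2.trans hx.2⟩
  have : 0 ≤ ν x := (norm_nonneg _).trans (hle x hx)
  nlinarith [mul_nonneg this hδ.le]

/-! ### Fast-slow systems S' = A S + δ p β, δ p' = ℓ(S) - p. -/

section Estimates

variable {E : Type*} [NormedAddCommGroup E] [NormedSpace ℂ E]
  {A A₀ A₁ : ℝ → E →ₗ[ℂ] E} {β β₀ : ℝ → E} {ℓ : E →L[ℂ] ℂ} {S S₀ N : ℝ → E} {M X : ℝ}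

theorem relaxation_identity (hδ : 0 < δ) (z w : ℂ) : δ * ((z - w) / δ) + w = z := by
  have : (δ : ℂ) ≠ 0 := by exact_mod_cast hδ.ne'
  field_simp
  ring

/-- The fast variable forces S by δ p β, and the L¹ relaxation estimate gives δ M ∫ ‖p‖ ≤ M δ² ‖p 0‖
+ δ M ∫ ‖S‖. One factor δ in the first term is the coupling, the other the length of the initial
layer. The second term is absorbed by Gronwall, which doubles the rate to 2 M. -/
theorem norm_slow_le (hδ : 0 < δ) (hδ1 : δ ≤ 1) (hM : 0 ≤ M)
    (hS : ∀ x, HasDerivAt S (A x (S x) + (δ * p x) • β x) x)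
    (hp : ∀ x, HasDerivAt p ((ℓ (S x) - p x) / δ) x)
    (hA : ∀ x ∈ Icc 0 X, ∀ v, ‖A x v‖ ≤ M * ‖v‖) (hβ : ∀ x ∈ Icc 0 X, ‖β x‖ ≤ M)
    (hℓ : ∀ v, ‖ℓ v‖ ≤ ‖v‖) {x : ℝ} (hx : x ∈ Icc 0 X) :
    ‖S x‖ ≤ (‖S 0‖ + M * δ ^ 2 * ‖p 0‖) * Real.exp (2 * M * X) := by
  have hSc : Continuous S := continuous_iff_continuousAt.mpr fun x => (hS x).continuousAt
  have hpc : Continuous p := continuous_iff_continuousAt.mpr fun x => (hp x).continuousAt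
  refine (le_mul_exp_of_le_add_mul_integral (f := fun x => ‖S x‖) (M := 2 * M) hSc.norm
    (by positivity) (C := ‖S 0‖ + M * δ ^ 2 * ‖p 0‖) (fun y hy => ?_) hx).trans ?_
  · have h1 := norm_le_add_integral_of_norm_deriv_le
      (φ := fun x => M * ‖S x‖ + δ * M * ‖p x‖) (by fun_prop) hS (X := X) (fun z hz => by
        refine (norm_add_le _ _).trans (add_le_add (hA z hz _) ?_)
        rw [norm_smul, norm_mul, Complex.norm_real, Real.norm_of_nonneg hδ.le]
        have := mul_le_mul_of_nonneg_left (hβ z hz)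
          (mul_nonneg hδ.le (norm_nonneg (p z)))
        linarith) hy
    rw [intervalIntegral.integral_add (Continuous.intervalIntegrable (by fun_prop) _ _)
      (Continuous.intervalIntegrable (by fun_prop) _ _), intervalIntegral.integral_const_mul,
      intervalIntegral.integral_const_mul] at h1
    have h2 := integral_norm_le_of_relaxation hδ hp (γ := fun x => ‖S x‖) hSc.norm (X := X)
      (fun z _ => by rw [relaxation_identity hδ]; exact hℓ _) hy
    have h3 : 0 ≤ ∫ t in (0 : ℝ)..y, ‖S t‖ :=
      intervalIntegral.integral_nonneg hy.1 fun _ _ => norm_nonneg _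
    have h4 := mul_le_mul_of_nonneg_left h2 (mul_nonneg hδ.le hM)
    have h5 : δ * M * ∫ t in (0 : ℝ)..y, ‖S t‖ ≤ 1 * M * ∫ t in (0 : ℝ)..y, ‖S t‖ := by gcongr
    calc ‖S y‖ ≤ _ := h1
      _ ≤ _ := by linarith
  · have := hx.2
    gcongr

theorem norm_fast_le (hδ : 0 < δ) (hδ1 : δ ≤ 1) (hM : 0 ≤ M)
    (hS : ∀ x, HasDerivAt S (A x (S x) + (δ * p x) • β x) x)
    (hp : ∀ x, HasDerivAt p ((ℓ (S x) - p x) / δ) x)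
    (hA : ∀ x ∈ Icc 0 X, ∀ v, ‖A x v‖ ≤ M * ‖v‖) (hβ : ∀ x ∈ Icc 0 X, ‖β x‖ ≤ M)
    (hℓ : ∀ v, ‖ℓ v‖ ≤ ‖v‖) {x : ℝ} (hx : x ∈ Icc 0 X) :
    ‖p x‖ ≤ Real.exp (-(x / δ)) * ‖p 0‖
      + (‖S 0‖ + M * δ ^ 2 * ‖p 0‖) * Real.exp (2 * M * X) :=
  norm_le_of_relaxation hδ hp (fun z hz => by
    rw [relaxation_identity hδ]
    exact (hℓ _).trans (norm_slow_le hδ hδ1 hM hS hp hA hβ hℓ hz)) hx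

/-- First order expansion of the slow variable of a fast-slow system whose fast variable starts at
`0`: the slow variable follows the reduced system up to `O(δ²)`. -/
theorem norm_slow_sub_expansion_le {s n : ℝ} (hδ : 0 < δ) (hδ1 : δ ≤ 1) (hM : 0 ≤ M)
    (hS : ∀ x, HasDerivAt S (A x (S x) + (δ * p x) • β x) x)
    (hp : ∀ x, HasDerivAt p ((ℓ (S x) - p x) / δ) x)
    (hS₀ : ∀ x, HasDerivAt S₀ (A₀ x (S₀ x)) x)
    (hN : ∀ x, HasDerivAt N (A₀ x (N x) + (A₁ x (S₀ x) + ℓ (S₀ x) • β₀ x)) x)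
    (hp0 : p 0 = 0) (hS0 : S₀ 0 = S 0) (hN0 : N 0 = 0) (hS1 : ‖S 0‖ ≤ 1)
    (hA : ∀ x ∈ Icc 0 X, ∀ v, ‖A x v‖ ≤ M * ‖v‖) (hβ : ∀ x ∈ Icc 0 X, ‖β x‖ ≤ M)
    (hA₁ : ∀ x ∈ Icc 0 X, ∀ v, ‖A₁ x v‖ ≤ M * ‖v‖) (hℓ : ∀ v, ‖ℓ v‖ ≤ ‖v‖)
    (hAexp : ∀ x ∈ Icc 0 X, ∀ v, ‖A x v - A₀ x v - (δ : ℂ) • A₁ x v‖ ≤ M * δ ^ 2 * ‖v‖)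
    (hβexp : ∀ x ∈ Icc 0 X, ‖β x - β₀ x‖ ≤ M * δ)
    (hs : ∀ x ∈ Icc 0 X, ‖S₀ x‖ ≤ s) (hes : Real.exp (2 * M * X) ≤ s)
    (hn : ∀ x ∈ Icc 0 X, ‖N x‖ ≤ n) {x : ℝ} (hx : x ∈ Icc 0 X) :
    ‖S x - S₀ x - (δ : ℂ) • N x‖
      ≤ ((2 * M * s + 3 * M * n) * X + M * (1 + 2 * M * s * X)) * δ ^ 2
        * Real.exp (2 * M * X) := by
  have hX : 0 ≤ X := hx.1.trans hx.2
  have hs0 : 0 ≤ s := (Real.exp_pos _).le.trans hes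
  have hn0 : 0 ≤ n := (norm_nonneg _).trans (hn x hx)
  have hpc : Continuous p := continuous_iff_continuousAt.mpr fun x => (hp x).continuousAt
  have hSc : Continuous S := continuous_iff_continuousAt.mpr fun x => (hS x).continuousAt
  have nδ : ‖(δ : ℂ)‖ = δ := by rw [Complex.norm_real, Real.norm_of_nonneg hδ.le]
  have hSs : ∀ y ∈ Icc 0 X, ‖S y‖ ≤ s := fun y hy => by
    refine (norm_slow_le hδ hδ1 hM hS hp hA hβ hℓ hy).trans (le_trans ?_ hes)
    rw [hp0, norm_zero, mul_zero, add_zero]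
    exact mul_le_of_le_one_left (Real.exp_pos _).le hS1
  have hps : ∀ y ∈ Icc 0 X, ‖p y‖ ≤ s := fun y hy => by
    refine (norm_fast_le hδ hδ1 hM hS hp hA hβ hℓ hy).trans (le_trans ?_ hes)
    rw [hp0, norm_zero, mul_zero, mul_zero, add_zero, zero_add]
    exact mul_le_of_le_one_left (Real.exp_pos _).le hS1
  -- The defect q = p - ℓ(S) satisfies δ q' + q = -δ ℓ(S'). Since S' is bounded by 2 M s, its L¹
  -- norm is O(δ), even though q(0) = -ℓ(S 0) is of order one.
  have hd : ∀ x, HasDerivAt (fun x => p x - ℓ (S x))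
      ((ℓ (S x) - p x) / δ - ℓ (A x (S x) + (δ * p x) • β x)) x := fun x =>
    (hp x).sub ((ℓ.restrictScalars ℝ).hasFDerivAt.comp_hasDerivAt x (hS x))
  have hdint : ∀ y ∈ Icc 0 X, ∫ t in (0 : ℝ)..y, ‖p t - ℓ (S t)‖ ≤ δ * (1 + 2 * M * s * X) := by
    intro y hy
    have h := integral_norm_le_of_relaxation hδ hd (γ := fun _ => δ * (2 * M * s))
      continuous_const (X := X) (fun z hz => by
        have e : δ * ((ℓ (S z) - p z) / δ - ℓ (A z (S z) + (δ * p z) • β z)) + (p z - ℓ (S z))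
          = -(δ * ℓ (A z (S z) + (δ * p z) • β z)) := by
          have : (δ : ℂ) ≠ 0 := by exact_mod_cast hδ.ne'
          field_simp
          ring
        rw [e, norm_neg, norm_mul, nδ]
        refine mul_le_mul_of_nonneg_left ((hℓ _).trans ?_) hδ.le
        refine (norm_add_le _ _).trans ?_
        have h1 := (hA z hz (S z)).trans (mul_le_mul_of_nonneg_left (hSs z hz) hM)
        have h2 : ‖(δ * p z) • β z‖ ≤ 1 * s * M := by
          rw [norm_smul, norm_mul, nδ]
          exact mul_le_mul (mul_le_mul hδ1 (hps z hz) (norm_nonneg _) zero_le_one) (hβ z hz)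
            (norm_nonneg _) (by positivity)
        linarith) hy
    rw [intervalIntegral.integral_const, hp0, zero_sub, norm_neg, smul_eq_mul, sub_zero] at h
    have h1 : ‖ℓ (S 0)‖ ≤ 1 := (hℓ _).trans hS1
    calc _ ≤ _ := h
      _ ≤ δ * 1 + X * (δ * (2 * M * s)) := by
        have := hy.2
        gcongr
      _ = _ := by ring
  -- The rate 2 M collects M from A and M from the feedback of the error through β. The forcing φ
  -- contains the defect, which is small only in L¹; this is why the Gronwall inequality with
  -- integrated forcing is needed.
  have key := norm_le_mul_exp_of_norm_deriv_le (X := X) (M := 2 * M)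
    (D := fun x => S x - S₀ x - (δ : ℂ) • N x)
    (D' := fun x => (A x (S x) + (δ * p x) • β x) - A₀ x (S₀ x)
      - (δ : ℂ) • (A₀ x (N x) + (A₁ x (S₀ x) + ℓ (S₀ x) • β₀ x)))
    (φ := fun x => δ ^ 2 * (2 * M * s + 3 * M * n) + δ * M * ‖p x - ℓ (S x)‖)
    (F := ((2 * M * s + 3 * M * n) * X + M * (1 + 2 * M * s * X)) * δ ^ 2)
    (by fun_prop) (by positivity) (fun x => ((hS x).sub (hS₀ x)).sub ((hN x).const_smul (δ : ℂ)))
    (fun z hz => ?_) (fun y hy => ?_) hx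
  · simpa [hS0, hN0] using key
  -- Here p is split as (p - ℓ(S)) + ℓ(D) + ℓ(S₀) + δ ℓ(N), where D is the error. The terms free of
  -- D are O(δ²) pointwise, except the defect term, which is O(δ²) after integration.
  · have e : (A z (S z) + (δ * p z) • β z) - A₀ z (S₀ z)
        - (δ : ℂ) • (A₀ z (N z) + (A₁ z (S₀ z) + ℓ (S₀ z) • β₀ z))
        = A z (S z - S₀ z - (δ : ℂ) • N z) + (A z (S₀ z) - A₀ z (S₀ z) - (δ : ℂ) • A₁ z (S₀ z))
          + (δ : ℂ) • ((A z (N z) - A₀ z (N z) - (δ : ℂ) • A₁ z (N z)) + (δ : ℂ) • A₁ z (N z))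
          + ((δ : ℂ) * (p z - ℓ (S z))) • β z
          + ((δ : ℂ) * (ℓ (S z - S₀ z - (δ : ℂ) • N z) + δ * ℓ (N z))) • β z
          + ((δ : ℂ) * ℓ (S₀ z)) • (β z - β₀ z) := by
      simp only [map_sub, map_smul, smul_eq_mul]
      module
    rw [e]
    set D := S z - S₀ z - (δ : ℂ) • N z
    have b1 := hA z hz D
    have b2 : ‖A z (S₀ z) - A₀ z (S₀ z) - (δ : ℂ) • A₁ z (S₀ z)‖ ≤ M * δ ^ 2 * s :=
      (hAexp z hz _).trans (mul_le_mul_of_nonneg_left (hs z hz) (by positivity))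
    have b3 : ‖(δ : ℂ) • ((A z (N z) - A₀ z (N z) - (δ : ℂ) • A₁ z (N z))
        + (δ : ℂ) • A₁ z (N z))‖ ≤ δ * (M * δ * 1 * n + δ * (M * n)) := by
      rw [norm_smul, nδ]
      refine mul_le_mul_of_nonneg_left ((norm_add_le _ _).trans (add_le_add ?_ ?_)) hδ.le
      · refine (hAexp z hz _).trans ?_
        have := hn z hz
        rw [sq, ← mul_assoc]
        gcongr
      · rw [norm_smul, nδ]
        exact mul_le_mul_of_nonneg_left
          ((hA₁ z hz _).trans (mul_le_mul_of_nonneg_left (hn z hz) hM)) hδ.le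
    have b4 : ‖((δ : ℂ) * (p z - ℓ (S z))) • β z‖ ≤ δ * M * ‖p z - ℓ (S z)‖ := by
      rw [norm_smul, norm_mul, nδ]
      have := mul_le_mul_of_nonneg_left (hβ z hz)
        (mul_nonneg hδ.le (norm_nonneg (p z - ℓ (S z))))
      linarith
    have b5 : ‖((δ : ℂ) * (ℓ D + δ * ℓ (N z))) • β z‖ ≤ δ * (‖D‖ + δ * n) * M := by
      rw [norm_smul, norm_mul, nδ]
      refine mul_le_mul (mul_le_mul_of_nonneg_left ((norm_add_le _ _).trans
        (add_le_add (hℓ _) ?_)) hδ.le) (hβ z hz) (norm_nonneg _) (by positivity)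
      rw [norm_mul, nδ]
      exact mul_le_mul_of_nonneg_left ((hℓ _).trans (hn z hz)) hδ.le
    have b6 : ‖((δ : ℂ) * ℓ (S₀ z)) • (β z - β₀ z)‖ ≤ δ * s * (M * δ) := by
      rw [norm_smul, norm_mul, nδ]
      exact mul_le_mul (mul_le_mul_of_nonneg_left ((hℓ _).trans (hs z hz)) hδ.le) (hβexp z hz)
        (norm_nonneg _) (by positivity)
    have b7 : δ * ‖D‖ * M ≤ 1 * ‖D‖ * M := by gcongr
    refine (norm_add_le_of_le (norm_add_le_of_le (norm_add_le_of_le (norm_add_le_of_le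
      (norm_add_le_of_le b1 b2) b3) b4) b5) b6).trans ?_
    linarith
  · rw [intervalIntegral.integral_add (Continuous.intervalIntegrable (by fun_prop) _ _)
      (Continuous.intervalIntegrable (by fun_prop) _ _), intervalIntegral.integral_const,
      intervalIntegral.integral_const_mul, smul_eq_mul, sub_zero]
    have h1 := mul_le_mul_of_nonneg_left (hdint y hy) (mul_nonneg hδ.le hM)
    have h2 : y * (δ ^ 2 * (2 * M * s + 3 * M * n)) ≤ X * (δ ^ 2 * (2 * M * s + 3 * M * n)) :=
      mul_le_mul_of_nonneg_right hy.2 (by positivity)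
    linarith

end Estimates

end FastSlow

/-! ### Determinants -/

section Determinants

open Matrix

theorem norm_det_le_factorial_mul_prod {n : ℕ} (A : Fin n → Fin n → ℂ) :
    ‖(Matrix.of A).det‖ ≤ n.factorial * ∏ i, ‖A i‖ := by
  rw [← Matrix.det_transpose, Matrix.det_apply]
  refine (norm_sum_le_of_le _ (f := fun σ : Equiv.Perm (Fin n) => _)
    (n := fun _ => ∏ i, ‖A i‖) fun σ _ => ?_).trans ?_
  · rcases Int.units_eq_one_or (Equiv.Perm.sign σ) with h | h <;>
      simp only [h, one_smul, Units.neg_smul, norm_neg, Matrix.transpose_apply, norm_prod] <;>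
      exact Finset.prod_le_prod (fun _ _ => norm_nonneg _) fun i _ => norm_le_pi_norm (A i) _
  · simp [Fintype.card_perm]

/-- The determinant is multilinear in the rows and, by the Leibniz formula, bounded with constant
n!; the general Lipschitz estimate for bounded multilinear maps applies. -/
theorem norm_det_sub_det_le {n : ℕ} {A B : Matrix (Fin n) (Fin n) ℂ} {C ε : ℝ} (hC : 0 ≤ C)
    (hε : 0 ≤ ε) (hA : ∀ i j, ‖A i j‖ ≤ C) (hB : ∀ i j, ‖B i j‖ ≤ C)
    (hAB : ∀ i j, ‖A i j - B i j‖ ≤ ε) :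
    ‖A.det - B.det‖ ≤ n.factorial * n * C ^ (n - 1) * ε := by
  have pi : ∀ (F : Fin n → Fin n → ℂ) (c : ℝ), 0 ≤ c → (∀ i j, ‖F i j‖ ≤ c) → ‖F‖ ≤ c :=
    fun F c hc h => (pi_norm_le_iff_of_nonneg hc).mpr fun i =>
      (pi_norm_le_iff_of_nonneg hc).mpr fun j => h i j
  have key : ∀ F G : Fin n → Fin n → ℂ, ‖F‖ ≤ C → ‖G‖ ≤ C → ‖F - G‖ ≤ ε →
      ‖(Matrix.of F).det - (Matrix.of G).det‖ ≤ n.factorial * n * C ^ (n - 1) * ε := by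
    intro F G hF hG hFG
    have h := (Matrix.detRowAlternating (R := ℂ) (n := Fin n)).norm_image_sub_le_of_bound
      (C := n.factorial) (by positivity) norm_det_le_factorial_mul_prod F G
    refine h.trans ?_
    rw [Fintype.card_fin]
    have hm : max ‖F‖ ‖G‖ ≤ C := max_le hF hG
    have h0 : 0 ≤ max ‖F‖ ‖G‖ := (norm_nonneg _).trans (le_max_left _ _)
    gcongr
  exact key A B (pi A C hC hA) (pi B C hC hB) (pi _ ε hε hAB)

/-- The matrix with upper left block `Q`, last row `(t, d)` and vanishing last column otherwise. -/
def bordered {n : ℕ} (Q : Matrix (Fin n) (Fin n) ℂ) (t : Fin n → ℂ) (d : ℂ) :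
    Matrix (Fin (n + 1)) (Fin (n + 1)) ℂ :=
  fun i j => Fin.lastCases (motive := fun _ => ℂ)
    (Fin.lastCases (motive := fun _ => ℂ) d t j)
    (fun i' => Fin.lastCases (motive := fun _ => ℂ) 0 (Q i') j) i

section
variable {n : ℕ} (Q : Matrix (Fin n) (Fin n) ℂ) (t : Fin n → ℂ) (d : ℂ)

@[simp] theorem bordered_last_last : bordered Q t d (Fin.last n) (Fin.last n) = d := by
  simp [bordered]
@[simp] theorem bordered_last_castSucc (j : Fin n) :
    bordered Q t d (Fin.last n) j.castSucc = t j := by simp [bordered]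
@[simp] theorem bordered_castSucc_last (i : Fin n) :
    bordered Q t d i.castSucc (Fin.last n) = 0 := by simp [bordered]
@[simp] theorem bordered_castSucc_castSucc (i j : Fin n) :
    bordered Q t d i.castSucc j.castSucc = Q i j := by simp [bordered]

theorem det_bordered : (bordered Q t d).det = d * Q.det := by
  rw [Matrix.det_succ_column _ (Fin.last n), Fin.sum_univ_castSucc]
  have : (bordered Q t d).submatrix Fin.castSucc Fin.castSucc = Q := by
    ext i j; simp
  simp [this, ← two_mul, pow_mul]

end

/-- Jacobi's formula with its exact remainder; the remainder is polynomial in the entries, so it is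
bounded uniformly on bounded sets. -/
theorem det_add_smul_three (A N : Matrix (Fin 3) (Fin 3) ℂ) (z : ℂ) :
    (A + z • N).det = A.det + z * (A.adjugate * N).trace
      + z ^ 2 * ((A * N.adjugate).trace + z * N.det) := by
  simp only [Matrix.det_fin_three, Matrix.adjugate_fin_three, Matrix.trace_fin_three,
    Matrix.mul_apply, Fin.sum_univ_three, Matrix.add_apply, Matrix.smul_apply, smul_eq_mul]
  simp
  ring

/-- The uniform bound is the boundedness of a continuous function on a closed ball of a
finite-dimensional space. -/
theorem exists_norm_le_of_continuous_entries {n : ℕ}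
    {F : (Fin n → Fin n → ℂ) × (Fin n → Fin n → ℂ) × ℂ → ℂ} (hF : Continuous F) (C : ℝ) :
    ∃ C' : ℝ, 0 ≤ C' ∧ ∀ (A N : Matrix (Fin n) (Fin n) ℂ) (z : ℂ), (∀ i j, ‖A i j‖ ≤ C) →
      (∀ i j, ‖N i j‖ ≤ C) → ‖z‖ ≤ 1 → ‖F (A, N, z)‖ ≤ C' := by
  have hc : IsCompact (Metric.closedBall (0 : (Fin n → Fin n → ℂ) × (Fin n → Fin n → ℂ) × ℂ)
    (max C 1)) := isCompact_closedBall _ _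
  obtain ⟨C', hC'⟩ := hc.exists_bound_of_continuousOn hF.continuousOn
  have h1 : 0 ≤ max C 1 := zero_le_one.trans (le_max_right _ _)
  refine ⟨max C' 0, le_max_right _ _, fun A N z hA hN hz => (hC' _ ?_).trans (le_max_left _ _)⟩
  have pi : ∀ (F : Fin n → Fin n → ℂ), (∀ i j, ‖F i j‖ ≤ C) → ‖F‖ ≤ max C 1 :=
    fun F h => (pi_norm_le_iff_of_nonneg h1).mpr fun i =>
      (pi_norm_le_iff_of_nonneg h1).mpr fun j => (h i j).trans (le_max_left _ _)
  rw [mem_closedBall_zero_iff, Prod.norm_def, Prod.norm_def]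
  exact max_le (pi A hA) (max_le (pi N hN) (hz.trans (le_max_right _ _)))

/-- First order expansion of a `3 × 3` determinant, uniform on bounded sets. -/
theorem exists_det_expansion_bound (C : ℝ) :
    ∃ C' : ℝ, 0 ≤ C' ∧ ∀ (A N : Matrix (Fin 3) (Fin 3) ℂ), (∀ i j, ‖A i j‖ ≤ C) →
      (∀ i j, ‖N i j‖ ≤ C) → ‖(A.adjugate * N).trace‖ ≤ C' ∧
        ∀ z : ℂ, ‖z‖ ≤ 1 → ‖(A + z • N).det - (A.det + z * (A.adjugate * N).trace)‖
          ≤ C' * ‖z‖ ^ 2 := by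
  obtain ⟨C₁, hC₁, h₁⟩ := exists_norm_le_of_continuous_entries (n := 3)
    (F := fun q => ((Matrix.of q.1).adjugate * Matrix.of q.2.1).trace)
    (((Continuous.matrix_adjugate continuous_fst).matrix_mul
      (continuous_fst.comp continuous_snd)).matrix_trace) C
  obtain ⟨C₂, hC₂, h₂⟩ := exists_norm_le_of_continuous_entries (n := 3)
    (F := fun q => ((Matrix.of q.1) * (Matrix.of q.2.1).adjugate).trace
      + q.2.2 * (Matrix.of q.2.1).det)
    ((Continuous.matrix_mul continuous_fst
      (continuous_fst.comp continuous_snd).matrix_adjugate).matrix_trace.add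
      ((continuous_snd.comp continuous_snd).mul
        (continuous_fst.comp continuous_snd).matrix_det)) C
  refine ⟨max C₁ C₂, hC₁.trans (le_max_left _ _), fun A N hA hN =>
    ⟨(h₁ A N 0 hA hN (by simp)).trans (le_max_left _ _), fun z hz => ?_⟩⟩
  rw [det_add_smul_three, add_sub_cancel_left, norm_mul, norm_pow, mul_comm]
  exact mul_le_mul_of_nonneg_right ((h₂ A N z hA hN hz).trans (le_max_right _ _)) (by positivity)

end Determinants

/-! ### The spectral problems as fast-slow systems -/

section Systems

open Set Matrix

/-- Coefficient matrix of the linearized KdV spectral problem in the unknowns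
`(v, v', v'' + a v)`, where `a = U - c`. -/
noncomputable def slowMatrix (a : ℝ → ℝ) (lam : ℂ) (x : ℝ) : Matrix (Fin 3) (Fin 3) ℂ :=
  !![0, 1, 0; -(a x : ℂ), 0, 1; -lam, 0, 0]

/-- First order correction in `δ` to `slowMatrix`. -/
noncomputable def slowCorrection (a₀ a₁ : ℝ → ℝ) (lam : ℂ) (x : ℝ) : Matrix (Fin 3) (Fin 3) ℂ :=
  !![0, 0, 0; -(a₁ x : ℂ), (a₀ x : ℂ) - 1, 0; 0, lam, 0]

/-- Coefficient matrix of the linearized KdV-KS spectral problem in the unknowns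
`(v + δ v', v' + δ v'', v'' + a v + δ (v' + v'''), v')`, where `a = U - c`. -/
noncomputable def fastSlowMatrix (δ : ℝ) (a : ℝ → ℝ) (lam : ℂ) (x : ℝ) :
    Matrix (Fin 4) (Fin 4) ℂ :=
  !![0, 1, 0, 0;
     -(a x : ℂ), 0, 1, δ * ((a x : ℂ) - 1);
     -lam, 0, 0, δ * lam;
     0, 1 / δ, 0, -1 / δ]

theorem continuous_slowMatrix {a : ℝ → ℝ} (ha : Continuous a) (lam : ℂ) (i j : Fin 3) :
    Continuous fun x => slowMatrix a lam x i j := by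
  fin_cases i <;> fin_cases j <;> simp [slowMatrix] <;> fun_prop

theorem continuous_slowCorrection {a₀ a₁ : ℝ → ℝ} (ha₀ : Continuous a₀) (ha₁ : Continuous a₁)
    (lam : ℂ) (i j : Fin 3) : Continuous fun x => slowCorrection a₀ a₁ lam x i j := by
  fin_cases i <;> fin_cases j <;> simp [slowCorrection] <;> fun_prop

theorem continuous_fastSlowMatrix {a : ℝ → ℝ} (ha : Continuous a) (δ : ℝ) (lam : ℂ)
    (i j : Fin 4) : Continuous fun x => fastSlowMatrix δ a lam x i j := by
  fin_cases i <;> fin_cases j <;> simp [fastSlowMatrix] <;> fun_prop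

theorem continuous_kdvMatrix {U : ℝ → ℝ} (hU : Continuous U) (hU' : Continuous (deriv U)) (c : ℝ)
    (lam : ℂ) (i j : Fin 3) : Continuous fun x => kdvMatrix c U lam x i j := by
  fin_cases i <;> fin_cases j <;> simp [kdvMatrix] <;> fun_prop

theorem continuous_kdvksMatrix {U : ℝ → ℝ} (hU : Continuous U) (hU' : Continuous (deriv U))
    (δ c : ℝ) (lam : ℂ) (i j : Fin 4) : Continuous fun x => kdvksMatrix δ c U lam x i j := by
  fin_cases i <;> fin_cases j <;> simp [kdvksMatrix] <;> fun_prop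

/-- Replacing v'' by v'' + a v integrates the term (a v)' once, so the derivative of the profile
leaves the coefficients. The substitution is periodic and unimodular. -/
theorem evansKdV_eq {c X : ℝ} {U : ℝ → ℝ} (hU : ContDiff ℝ 1 U) (hper : Function.Periodic U X)
    (lam : ℂ) (ξ : ℝ) :
    evansKdV c X U lam ξ = (resolventMatrix (slowMatrix (fun x => U x - c) lam) X
      - Complex.exp (Complex.I * ξ * X) • (1 : Matrix (Fin 3) (Fin 3) ℂ)).det := by
  have hU' : Continuous (deriv U) := hU.continuous_deriv le_rfl
  have hd : ∀ x, HasDerivAt (fun y => (U y : ℂ)) ((deriv U x : ℝ) : ℂ) x := fun x =>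
    ((hU.differentiable one_ne_zero) x).hasDerivAt.ofReal_comp
  refine det_resolventMatrix_sub_eq_of_gauge
    (P := fun x => !![1, 0, 0; 0, 1, 0; ((U x - c : ℝ) : ℂ), 0, 1])
    (P' := fun x => !![0, 0, 0; 0, 0, 0; ((deriv U x : ℝ) : ℂ), 0, 0])
    (continuous_kdvMatrix hU.continuous hU' c lam)
    (continuous_slowMatrix (by have := hU.continuous; fun_prop) lam) ?_ ?_ ?_ ?_ _
  · intro i j x
    fin_cases i <;> fin_cases j <;> simp [hasDerivAt_const, hd x]
  · intro x
    ext i j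
    fin_cases i <;> fin_cases j <;>
      simp [kdvMatrix, slowMatrix, Matrix.mul_apply, Fin.sum_univ_three]
  · simp [Matrix.det_fin_three]
  · have := hper 0
    simp only [zero_add] at this
    simp [this]

/-- The substitution desingularizes the problem: only the equation of the last unknown v' keeps the
factor 1/δ, with the decaying sign. Its matrix is periodic with determinant δ², so no scalar factor
appears. -/
theorem evansKdVKS_eq {δ c X : ℝ} {U : ℝ → ℝ} (hδ : 0 < δ) (hU : ContDiff ℝ 1 U)
    (hper : Function.Periodic U X) (lam : ℂ) (ξ : ℝ) :
    evansKdVKS δ c X U lam ξ = (resolventMatrix (fastSlowMatrix δ (fun x => U x - c) lam) X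
      - Complex.exp (Complex.I * ξ * X) • (1 : Matrix (Fin 4) (Fin 4) ℂ)).det := by
  have hU' : Continuous (deriv U) := hU.continuous_deriv le_rfl
  have hd : ∀ x, HasDerivAt (fun y => (U y : ℂ)) ((deriv U x : ℝ) : ℂ) x := fun x =>
    ((hU.differentiable one_ne_zero) x).hasDerivAt.ofReal_comp
  have hδ' : (δ : ℂ) ≠ 0 := by exact_mod_cast hδ.ne'
  refine det_resolventMatrix_sub_eq_of_gauge
    (P := fun x => !![1, δ, 0, 0; 0, 1, δ, 0; ((U x - c : ℝ) : ℂ), δ, 1, δ; 0, 1, 0, 0])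
    (P' := fun x => !![0, 0, 0, 0; 0, 0, 0, 0; ((deriv U x : ℝ) : ℂ), 0, 0, 0; 0, 0, 0, 0])
    (continuous_kdvksMatrix hU.continuous hU' δ c lam)
    (continuous_fastSlowMatrix (by have := hU.continuous; fun_prop) δ lam) ?_ ?_ ?_ ?_ _
  · intro i j x
    fin_cases i <;> fin_cases j <;> simp [hasDerivAt_const, hd x]
  · intro x
    ext i j
    fin_cases i <;> fin_cases j <;>
      simp [kdvksMatrix, fastSlowMatrix, Matrix.mul_apply, Fin.sum_univ_four] <;>
      field_simp <;> ring
  · rw [isUnit_iff_ne_zero]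
    simp [Matrix.det_succ_row_zero, Fin.sum_univ_succ, Fin.succAbove, hδ']
  · have := hper 0
    simp only [zero_add] at this
    simp [this]

end Systems

/-! ### Expansion of the Evans function -/

section Expansion

open Set Matrix

theorem norm_slowMatrix_mulVec_le {a : ℝ → ℝ} {lam : ℂ} {x M : ℝ} (hM : 1 + |a x| + ‖lam‖ ≤ M)
    (v : Fin 3 → ℂ) : ‖(slowMatrix a lam x).mulVecLin v‖ ≤ M * ‖v‖ := by
  have h0 := norm_le_pi_norm v 0
  have h1 := norm_le_pi_norm v 1
  have h2 := norm_le_pi_norm v 2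
  have ha := abs_nonneg (a x)
  have hl := norm_nonneg lam
  have hv := norm_nonneg v
  have hM0 : 0 ≤ M := by linarith
  refine le_trans ((pi_norm_le_iff_of_nonneg (by positivity :
    0 ≤ (1 + |a x| + ‖lam‖) * ‖v‖)).mpr fun i => ?_) (by gcongr)
  have e1 : |a x| * ‖v 0‖ ≤ |a x| * ‖v‖ := by gcongr
  have e2 : ‖lam‖ * ‖v 0‖ ≤ ‖lam‖ * ‖v‖ := by gcongr
  have p1 : 0 ≤ |a x| * ‖v‖ := by positivity
  have p2 : 0 ≤ ‖lam‖ * ‖v‖ := by positivity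
  fin_cases i
  · simp [slowMatrix, Matrix.mulVec, dotProduct, Fin.sum_univ_three]
    linarith
  · simp [slowMatrix, Matrix.mulVec, dotProduct, Fin.sum_univ_three]
    refine (norm_add_le _ _).trans ?_
    simp
    linarith
  · simp [slowMatrix, Matrix.mulVec, dotProduct, Fin.sum_univ_three]
    linarith

theorem norm_matrix_single_mulVec_le (z : ℂ) (v : Fin 3 → ℂ) :
    ‖(!![0, 0, 0; -z, 0, 0; 0, 0, 0] : Matrix (Fin 3) (Fin 3) ℂ).mulVecLin v‖ ≤ ‖z‖ * ‖v‖ := by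
  have h0 := norm_le_pi_norm v 0
  refine (pi_norm_le_iff_of_nonneg (by positivity)).mpr fun i => ?_
  fin_cases i
  · simp [Matrix.mulVec, dotProduct, Fin.sum_univ_three]; positivity
  · simp [Matrix.mulVec, dotProduct, Fin.sum_univ_three]; gcongr
  · simp [Matrix.mulVec, dotProduct, Fin.sum_univ_three]; positivity

theorem norm_vec_zero_le {z w : ℂ} : ‖(![0, z, w] : Fin 3 → ℂ)‖ ≤ ‖z‖ + ‖w‖ := by
  have h1 := norm_nonneg z
  have h2 := norm_nonneg w
  refine (pi_norm_le_iff_of_nonneg (by positivity)).mpr fun i => ?_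
  fin_cases i <;> (simp; try linarith)

theorem IsResolventMatrix.hasDerivAt_col {n : ℕ} {A R : ℝ → Matrix (Fin n) (Fin n) ℂ}
    (hR : IsResolventMatrix A R) (j : Fin n) (x : ℝ) :
    HasDerivAt (fun y i => R y i j) ((A x).mulVecLin fun i => R x i j) x :=
  hasDerivAt_pi.mpr fun i => hR.2 i j x

/-- Each column of the resolvent matrix is a solution of the abstract fast-slow system with β = (0,
a - 1, λ); in `hasDerivAt_fast_col` the functional ℓ is the second coordinate. -/
theorem hasDerivAt_slow_col {δ : ℝ} {a : ℝ → ℝ} {lam : ℂ} {T : ℝ → Matrix (Fin 4) (Fin 4) ℂ}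
    (hT : IsResolventMatrix (fastSlowMatrix δ a lam) T) (j : Fin 4) (x : ℝ) :
    HasDerivAt (fun y (i : Fin 3) => T y i.castSucc j)
      ((slowMatrix a lam x).mulVecLin (fun i => T x i.castSucc j)
        + (δ * T x 3 j) • ![0, (a x : ℂ) - 1, lam]) x := by
  refine hasDerivAt_pi.mpr fun i => (hT.2 i.castSucc j x).congr_deriv ?_
  fin_cases i <;>
    simp [fastSlowMatrix, slowMatrix, Matrix.mul_apply, dotProduct, Fin.sum_univ_four,
      Fin.sum_univ_three] <;> ring

theorem hasDerivAt_fast_col {δ : ℝ} {a : ℝ → ℝ} {lam : ℂ} {T : ℝ → Matrix (Fin 4) (Fin 4) ℂ}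
    (hT : IsResolventMatrix (fastSlowMatrix δ a lam) T) (j : Fin 4) (x : ℝ) :
    HasDerivAt (fun y => T y 3 j) ((T x 1 j - T x 3 j) / δ) x := by
  refine (hT.2 3 j x).congr_deriv ?_
  simp [fastSlowMatrix, Matrix.mul_apply, Fin.sum_univ_four]
  ring

theorem norm_one_col_le {n m : ℕ} (f : Fin m → Fin n) (j : Fin n) :
    ‖(fun i => (1 : Matrix (Fin n) (Fin n) ℂ) (f i) j)‖ ≤ 1 := by
  refine (pi_norm_le_iff_of_nonneg zero_le_one).mpr fun i => ?_
  rw [Matrix.one_apply]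
  split_ifs <;> simp

/-- The correction has two sources: the first-order change a₁ of the potential, and the coupling δ p
β with p replaced by its quasi-static value s₂. -/
theorem slowCorrection_mul_col (a₀ a₁ : ℝ → ℝ) (lam : ℂ) (x : ℝ) (T : Matrix (Fin 3) (Fin 3) ℂ)
    (j : Fin 3) : (fun i => (slowCorrection a₀ a₁ lam x * T) i j)
      = (!![0, 0, 0; -(a₁ x : ℂ), 0, 0; 0, 0, 0] : Matrix (Fin 3) (Fin 3) ℂ).mulVecLin
          (fun i => T i j) + T 1 j • ![0, (a₀ x : ℂ) - 1, lam] := by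
  funext i
  fin_cases i <;> simp [slowCorrection, Matrix.mul_apply, dotProduct, Fin.sum_univ_three] <;> ring

/-- Uniform bounds for the reduced system and its first variation. -/
theorem exists_slow_bounds {X : ℝ} {a₀ a₁ : ℝ → ℝ} (ha₀ : Continuous a₀) (ha₁ : Continuous a₁)
    (Λ : ℝ) : ∃ C : ℝ, 0 ≤ C ∧ ∀ lam : ℂ, ‖lam‖ ≤ Λ → ∀ N : ℝ → Matrix (Fin 3) (Fin 3) ℂ,
      N 0 = 0 → (∀ i j x, HasDerivAt (fun y => N y i j) ((slowMatrix a₀ lam x * N x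
        + slowCorrection a₀ a₁ lam x * resolventMatrix (slowMatrix a₀ lam) x) i j) x) →
      ∀ j, ∀ x ∈ Icc 0 X, ‖(fun i => resolventMatrix (slowMatrix a₀ lam) x i j)‖ ≤ C ∧
        ‖(fun i => N x i j)‖ ≤ C := by
  obtain ⟨m₀, hm₀⟩ := (isCompact_Icc (a := 0) (b := X)).exists_bound_of_continuousOn
    ha₀.continuousOn
  obtain ⟨m₁, hm₁⟩ := (isCompact_Icc (a := 0) (b := X)).exists_bound_of_continuousOn
    ha₁.continuousOn
  set M : ℝ := 1 + |m₀| + |m₁| + |Λ| with hMdef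
  have hM : 0 ≤ M := by positivity
  set s := Real.exp (M * X) with hs
  have hs0 : 0 ≤ s := (Real.exp_pos _).le
  refine ⟨max s (X * (2 * M * s) * s), hs0.trans (le_max_left _ _), fun lam hlam N hN0 hN j => ?_⟩
  have hT := isResolventMatrix_resolventMatrix (continuous_slowMatrix ha₀ lam)
  have hlam' : ‖lam‖ ≤ |Λ| := hlam.trans (le_abs_self _)
  have b₀ : ∀ x ∈ Icc 0 X, |a₀ x| ≤ |m₀| := fun x hx => (hm₀ x hx).trans (le_abs_self _)
  have b₁ : ∀ x ∈ Icc 0 X, |a₁ x| ≤ |m₁| := fun x hx => (hm₁ x hx).trans (le_abs_self _)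
  have hA : ∀ x ∈ Icc 0 X, ∀ v, ‖(slowMatrix a₀ lam x).mulVecLin v‖ ≤ M * ‖v‖ := fun x hx v =>
    norm_slowMatrix_mulVec_le (by linarith [b₀ x hx, abs_nonneg m₁]) v
  have hTs : ∀ x ∈ Icc 0 X, ‖(fun i => resolventMatrix (slowMatrix a₀ lam) x i j)‖ ≤ s := by
    intro x hx
    have := norm_le_mul_exp_of_norm_deriv_le (φ := fun _ => 0) (F := 0) continuous_const hM
      (hT.hasDerivAt_col j) (fun z hz => by simpa using hA z hz _) (by simp) hx
    rw [hT.1, add_zero] at this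
    exact this.trans (mul_le_of_le_one_left hs0 (norm_one_col_le id j))
  refine fun x hx => ⟨(hTs x hx).trans (le_max_left _ _), le_trans ?_ (le_max_right _ _)⟩
  have hX : 0 ≤ X := hx.1.trans hx.2
  have key := norm_le_mul_exp_of_norm_deriv_le (D := fun x i => N x i j)
    (D' := fun x => (slowMatrix a₀ lam x).mulVecLin (fun i => N x i j)
      + fun i => (slowCorrection a₀ a₁ lam x * resolventMatrix (slowMatrix a₀ lam) x) i j)
    (φ := fun _ => 2 * M * s) (F := X * (2 * M * s)) (M := M) (X := X) continuous_const hM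
    (fun x => hasDerivAt_pi.mpr fun i => hN i j x) (fun z hz => ?_) (fun y hy => ?_) hx
  · simpa [hN0] using key
  · refine (norm_add_le _ _).trans (add_le_add (hA z hz _) ?_)
    rw [slowCorrection_mul_col]
    have t := hTs z hz
    have h1 := norm_matrix_single_mulVec_le (a₁ z : ℂ)
      (fun i => resolventMatrix (slowMatrix a₀ lam) z i j)
    have h2 : ‖(a₁ z : ℂ)‖ ≤ M := by
      rw [Complex.norm_real, Real.norm_eq_abs]
      linarith [b₁ z hz, abs_nonneg m₀, abs_nonneg Λ]
    have h3 : ‖(![0, (a₀ z : ℂ) - 1, lam] : Fin 3 → ℂ)‖ ≤ M := by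
      refine norm_vec_zero_le.trans ?_
      have : ‖(a₀ z : ℂ) - 1‖ ≤ |a₀ z| + 1 := (norm_sub_le _ _).trans (by simp)
      linarith [b₀ z hz, abs_nonneg m₁]
    have h4 := (norm_le_pi_norm (fun i => resolventMatrix (slowMatrix a₀ lam) z i j) 1).trans t
    calc _ ≤ M * s + s * M := by
          refine norm_add_le_of_le (h1.trans (mul_le_mul h2 t (norm_nonneg _) hM)) ?_
          rw [norm_smul]
          exact mul_le_mul h4 h3 (norm_nonneg _) hs0
      _ = 2 * M * s := by ring
  · rw [intervalIntegral.integral_const, smul_eq_mul, sub_zero]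
    exact mul_le_mul_of_nonneg_right hy.2 (by positivity)

/-- What remains of the initial layer after a full period is negligible at order δ², since exp(y) ≥
y²/2 for y ≥ 0. -/
theorem exp_neg_div_le {X δ : ℝ} (hX : 0 < X) (hδ : 0 < δ) :
    Real.exp (-(X / δ)) ≤ 2 / X ^ 2 * δ ^ 2 := by
  have h := Real.quadratic_le_exp_of_nonneg (div_pos hX hδ).le
  have h1 : 0 < (X / δ) ^ 2 / 2 := by positivity
  have h2 : (X / δ) ^ 2 / 2 ≤ Real.exp (X / δ) := by
    have := div_pos hX hδ
    linarith
  rw [Real.exp_neg]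
  calc (Real.exp (X / δ))⁻¹ ≤ ((X / δ) ^ 2 / 2)⁻¹ := by gcongr
    _ = _ := by field_simp

/-- Expansion of the monodromy matrix of the fast-slow system. -/
theorem exists_monodromy_expansion {X : ℝ} (hX : 0 < X) {a₀ a₁ : ℝ → ℝ} (ha₀ : Continuous a₀)
    (ha₁ : Continuous a₁) (Λ : ℝ) {Ca : ℝ} (hCa : 0 ≤ Ca) :
    ∃ C : ℝ, 0 ≤ C ∧ ∀ lam : ℂ, ‖lam‖ ≤ Λ → ∀ N : ℝ → Matrix (Fin 3) (Fin 3) ℂ,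
      N 0 = 0 → (∀ i j x, HasDerivAt (fun y => N y i j) ((slowMatrix a₀ lam x * N x
        + slowCorrection a₀ a₁ lam x * resolventMatrix (slowMatrix a₀ lam) x) i j) x) →
      ∀ δ ∈ Ioc (0 : ℝ) 1, ∀ a : ℝ → ℝ, Continuous a →
        (∀ x ∈ Icc 0 X, |a x - a₀ x - δ * a₁ x| ≤ Ca * δ ^ 2) →
        (∀ i j : Fin 3, ‖resolventMatrix (fastSlowMatrix δ a lam) X i.castSucc j.castSucc
          - resolventMatrix (slowMatrix a₀ lam) X i j - δ * N X i j‖ ≤ C * δ ^ 2) ∧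
        (∀ i, ‖resolventMatrix (fastSlowMatrix δ a lam) X i 3‖ ≤ C * δ ^ 2) ∧
        ∀ j, ‖resolventMatrix (fastSlowMatrix δ a lam) X 3 j‖ ≤ C := by
  obtain ⟨s, hs0, hs⟩ := exists_slow_bounds (X := X) ha₀ ha₁ Λ
  obtain ⟨m₀, hm₀⟩ := (isCompact_Icc (a := 0) (b := X)).exists_bound_of_continuousOn
    ha₀.continuousOn
  obtain ⟨m₁, hm₁⟩ := (isCompact_Icc (a := 0) (b := X)).exists_bound_of_continuousOn
    ha₁.continuousOn
  set M : ℝ := 1 + |m₀| + |m₁| + Ca + |Λ| with hMdef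
  have hM : 0 ≤ M := by positivity
  set E := Real.exp (2 * M * X) with hE
  have hE0 : 0 ≤ E := (Real.exp_pos _).le
  set r := max s E with hr
  have hr0 : 0 ≤ r := hs0.trans (le_max_left _ _)
  -- C₁ bounds the error in the slow block, C₂ the last column and C₃ the last row. The radius r
  -- dominates T₀, N and exp(2 M X), so it serves as both `s` and `n` in the expansion estimate.
  set C₁ := ((2 * M * r + 3 * M * r) * X + M * (1 + 2 * M * r * X)) * E with hC₁
  set C₂ := 2 / X ^ 2 + M * E with hC₂
  set C₃ := 1 + (1 + M) * E with hC₃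
  have hC₁0 : 0 ≤ C₁ := by positivity
  have hC₂0 : 0 ≤ C₂ := by positivity
  have hC₃0 : 0 ≤ C₃ := by positivity
  refine ⟨C₁ + C₂ + C₃, by positivity, fun lam hlam N hN0 hN δ hδ a ha haexp => ?_⟩
  have hδ0 := hδ.1
  have hδ2 : δ ^ 2 ≤ 1 := pow_le_one₀ hδ.1.le hδ.2
  have hδ2' : δ ^ 2 ≤ δ := by nlinarith [hδ.1, hδ.2]
  have hT := isResolventMatrix_resolventMatrix (continuous_fastSlowMatrix ha δ lam)
  have hT₀ := isResolventMatrix_resolventMatrix (continuous_slowMatrix ha₀ lam)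
  set T := resolventMatrix (fastSlowMatrix δ a lam)
  set T₀ := resolventMatrix (slowMatrix a₀ lam)
  have hlam' : ‖lam‖ ≤ |Λ| := hlam.trans (le_abs_self _)
  have b₀ : ∀ x ∈ Icc 0 X, |a₀ x| ≤ |m₀| := fun x hx => (hm₀ x hx).trans (le_abs_self _)
  have b₁ : ∀ x ∈ Icc 0 X, |a₁ x| ≤ |m₁| := fun x hx => (hm₁ x hx).trans (le_abs_self _)
  have bd : ∀ x ∈ Icc 0 X, |a x - a₀ x| ≤ (|m₁| + Ca) * δ := by
    intro x hx
    calc |a x - a₀ x| = |(a x - a₀ x - δ * a₁ x) + δ * a₁ x| := by ring_nf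
      _ ≤ Ca * δ ^ 2 + δ * |m₁| := by
        refine (abs_add_le _ _).trans (add_le_add (haexp x hx) ?_)
        rw [abs_mul, abs_of_pos hδ0]
        exact mul_le_mul_of_nonneg_left (b₁ x hx) hδ0.le
      _ ≤ _ := by nlinarith [mul_le_mul_of_nonneg_left hδ2' hCa]
  have ba : ∀ x ∈ Icc 0 X, |a x| ≤ |m₀| + |m₁| + Ca := by
    intro x hx
    have h1 : |a x| ≤ |a x - a₀ x| + |a₀ x| := by
      simpa using abs_add_le (a x - a₀ x) (a₀ x)
    have h2 : (|m₁| + Ca) * δ ≤ |m₁| + Ca := mul_le_of_le_one_right (by positivity) hδ.2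
    linarith [bd x hx, b₀ x hx]
  have hA : ∀ x ∈ Icc 0 X, ∀ v, ‖(slowMatrix a lam x).mulVecLin v‖ ≤ M * ‖v‖ := fun x hx v =>
    norm_slowMatrix_mulVec_le (by linarith [ba x hx]) v
  have hβ : ∀ x ∈ Icc 0 X, ‖(![0, (a x : ℂ) - 1, lam] : Fin 3 → ℂ)‖ ≤ M := by
    intro x hx
    refine norm_vec_zero_le.trans ?_
    have : ‖(a x : ℂ) - 1‖ ≤ |a x| + 1 := (norm_sub_le _ _).trans (by simp)
    linarith [ba x hx]
  have hA₁ : ∀ x ∈ Icc 0 X, ∀ v, ‖(!![0, 0, 0; -(a₁ x : ℂ), 0, 0; 0, 0, 0] :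
      Matrix (Fin 3) (Fin 3) ℂ).mulVecLin v‖ ≤ M * ‖v‖ := by
    intro x hx v
    refine (norm_matrix_single_mulVec_le _ v).trans
      (mul_le_mul_of_nonneg_right ?_ (norm_nonneg _))
    rw [Complex.norm_real, Real.norm_eq_abs]
    linarith [b₁ x hx, abs_nonneg m₀, abs_nonneg Λ]
  have hℓ : ∀ v : Fin 3 → ℂ, ‖(ContinuousLinearMap.proj (R := ℂ) (φ := fun _ : Fin 3 => ℂ) 1) v‖
      ≤ ‖v‖ := fun v => norm_le_pi_norm v 1
  have hS := hasDerivAt_slow_col hT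
  have hp := hasDerivAt_fast_col hT
  have hXm : X ∈ Icc 0 X := ⟨hX.le, le_rfl⟩
  refine ⟨fun i j => ?_, fun i => ?_, fun j => ?_⟩
  -- The first three columns start with p = 0, so there is no layer of order one in p at the initial
  -- point and the expansion estimate applies.
  · have key := norm_slow_sub_expansion_le (s := r) (n := r) (M := M) (X := X)
      (A := fun x => (slowMatrix a lam x).mulVecLin) (A₀ := fun x => (slowMatrix a₀ lam x).mulVecLin)
      (A₁ := fun x => (!![0, 0, 0; -(a₁ x : ℂ), 0, 0; 0, 0, 0] :
        Matrix (Fin 3) (Fin 3) ℂ).mulVecLin)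
      (β := fun x => ![0, (a x : ℂ) - 1, lam]) (β₀ := fun x => ![0, (a₀ x : ℂ) - 1, lam])
      (ℓ := ContinuousLinearMap.proj 1) (S := fun x i => T x i.castSucc j.castSucc)
      (p := fun x => T x 3 j.castSucc) (S₀ := fun x i => T₀ x i j) (N := fun x i => N x i j)
      hδ0 hδ.2 hM (hS _) (hp _) (hT₀.hasDerivAt_col j)
      (fun x => hasDerivAt_pi.mpr fun i => (hN i j x).congr_deriv
        (congrArg ((slowMatrix a₀ lam x * N x) i j + ·) 
          (congrFun (slowCorrection_mul_col a₀ a₁ lam x (T₀ x) j) i)))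
      (by simp only [hT.1]; fin_cases j <;> rfl)
      (by funext i; simp [hT.1, hT₀.1, Matrix.one_apply])
      (by funext i; simp [hN0])
      (by simp only [hT.1]; exact norm_one_col_le _ _)
      hA hβ hA₁ hℓ (fun x hx v => ?_) (fun x hx => ?_)
      (fun x hx => (hs lam hlam N hN0 hN j x hx).1.trans (le_max_left _ _)) (le_max_right _ _)
      (fun x hx => (hs lam hlam N hN0 hN j x hx).2.trans (le_max_left _ _)) hXm
    · refine (norm_le_pi_norm (_ : Fin 3 → ℂ) i).trans (key.trans ?_)
      have : C₁ * δ ^ 2 ≤ (C₁ + C₂ + C₃) * δ ^ 2 := by gcongr; linarith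
      linarith
    · have e : (slowMatrix a lam x).mulVecLin v - (slowMatrix a₀ lam x).mulVecLin v
          - (δ : ℂ) • (!![0, 0, 0; -(a₁ x : ℂ), 0, 0; 0, 0, 0] :
              Matrix (Fin 3) (Fin 3) ℂ).mulVecLin v
          = (!![0, 0, 0; -((a x - a₀ x - δ * a₁ x : ℝ) : ℂ), 0, 0; 0, 0, 0] :
              Matrix (Fin 3) (Fin 3) ℂ).mulVecLin v := by
        funext i
        fin_cases i <;> simp [slowMatrix, Matrix.mulVec, dotProduct, Fin.sum_univ_three]
        ring
      rw [e]
      refine (norm_matrix_single_mulVec_le _ v).trans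
        (mul_le_mul_of_nonneg_right ?_ (norm_nonneg _))
      rw [Complex.norm_real, Real.norm_eq_abs]
      refine (haexp x hx).trans (mul_le_mul_of_nonneg_right ?_ (by positivity))
      linarith [abs_nonneg m₀, abs_nonneg m₁, abs_nonneg Λ]
    · have e : (![0, (a x : ℂ) - 1, lam] : Fin 3 → ℂ) - ![0, (a₀ x : ℂ) - 1, lam]
          = ![0, ((a x - a₀ x : ℝ) : ℂ), 0] := by
        funext i; fin_cases i <;> simp
      rw [e]
      refine norm_vec_zero_le.trans ?_
      rw [norm_zero, add_zero, Complex.norm_real, Real.norm_eq_abs]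
      refine (bd x hx).trans (mul_le_mul_of_nonneg_right ?_ hδ0.le)
      linarith [abs_nonneg m₀, abs_nonneg Λ]
  -- The last column starts with S = 0 and p = 1: S is then O(δ²) throughout, and p(X) is O(δ²) plus
  -- exp(-X/δ).
  · have hS0 : (fun i : Fin 3 => T 0 i.castSucc 3) = 0 := by
      funext i; rw [hT.1]; fin_cases i <;> rfl
    have hp0 : ‖T 0 3 3‖ = 1 := by rw [hT.1]; simp
    have k1 := norm_slow_le (ℓ := ContinuousLinearMap.proj (R := ℂ) (φ := fun _ : Fin 3 => ℂ) 1)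
      (A := fun x => (slowMatrix a lam x).mulVecLin) hδ0 hδ.2 hM (hS 3) (hp 3) hA hβ hℓ hXm
    have k2 := norm_fast_le (ℓ := ContinuousLinearMap.proj (R := ℂ) (φ := fun _ : Fin 3 => ℂ) 1)
      (A := fun x => (slowMatrix a lam x).mulVecLin) hδ0 hδ.2 hM (hS 3) (hp 3) hA hβ hℓ hXm
    rw [hS0, hp0, norm_zero, mul_one, zero_add, ← hE] at k1 k2
    rw [mul_one] at k2
    have k3 := exp_neg_div_le hX hδ0
    have hx2 : 0 ≤ 2 / X ^ 2 * δ ^ 2 := by positivity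
    have hle : C₂ * δ ^ 2 ≤ (C₁ + C₂ + C₃) * δ ^ 2 := by gcongr; linarith
    refine Fin.lastCases (motive := fun i => ‖T X i 3‖ ≤ _) ?_ (fun i => ?_) i
    · exact k2.trans (le_trans (by rw [hC₂]; linarith) hle)
    · exact (norm_le_pi_norm (fun i : Fin 3 => T X i.castSucc 3) i).trans
        (k1.trans (le_trans (by rw [hC₂]; linarith) hle))
  -- Boundedness of the last row suffices, because that row does not enter the determinant once the
  -- last column is cleared above the diagonal.
  · have k2 := norm_fast_le (ℓ := ContinuousLinearMap.proj (R := ℂ) (φ := fun _ : Fin 3 => ℂ) 1)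
      (A := fun x => (slowMatrix a lam x).mulVecLin) hδ0 hδ.2 hM (hS j) (hp j) hA hβ hℓ hXm
    simp only [hT.1] at k2
    have n1 := norm_one_col_le (n := 4) (fun i : Fin 3 => i.castSucc) j
    have n2 : ‖(1 : Matrix (Fin 4) (Fin 4) ℂ) 3 j‖ ≤ 1 := by
      rw [Matrix.one_apply]; split_ifs <;> simp
    have e1 : Real.exp (-(X / δ)) ≤ 1 := Real.exp_le_one_iff.mpr (by
      have := div_pos hX hδ0; linarith)
    refine k2.trans ?_
    calc _ ≤ 1 * 1 + (1 + M * 1 * 1) * E := by gcongr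
      _ = C₃ := by rw [hC₃]; ring
      _ ≤ _ := by linarith

/-- First order expansion of the determinant of the fast-slow system. -/
theorem exists_evans_expansion {X : ℝ} (hX : 0 < X) {a₀ a₁ : ℝ → ℝ} (ha₀ : Continuous a₀)
    (ha₁ : Continuous a₁) : ∃ E₁ : ℂ → ℂ → ℂ, ∀ Λ Ca : ℝ, 0 ≤ Ca → ∃ C : ℝ, 0 ≤ C ∧
      ∀ lam : ℂ, ‖lam‖ ≤ Λ → ∀ μ : ℂ, ‖μ‖ = 1 → ‖E₁ lam μ‖ ≤ C ∧
      ∀ δ ∈ Ioc (0 : ℝ) 1, ∀ a : ℝ → ℝ, Continuous a →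
        (∀ x ∈ Icc 0 X, |a x - a₀ x - δ * a₁ x| ≤ Ca * δ ^ 2) →
        ‖(resolventMatrix (fastSlowMatrix δ a lam) X - μ • (1 : Matrix (Fin 4) (Fin 4) ℂ)).det
          - -μ * ((resolventMatrix (slowMatrix a₀ lam) X
            - μ • (1 : Matrix (Fin 3) (Fin 3) ℂ)).det + δ * E₁ lam μ)‖ ≤ C * δ ^ 2 := by
  have hex : ∀ lam : ℂ, ∃ N : ℝ → Matrix (Fin 3) (Fin 3) ℂ, N 0 = 0 ∧
      ∀ i j x, HasDerivAt (fun y => N y i j) ((slowMatrix a₀ lam x * N x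
        + slowCorrection a₀ a₁ lam x * resolventMatrix (slowMatrix a₀ lam) x) i j) x := fun lam =>
    exists_inhomogeneous_solution (continuous_slowMatrix ha₀ lam) fun i j => by
      simp only [Matrix.mul_apply]
      exact continuous_finsetSum _ fun r _ => (continuous_slowCorrection ha₀ ha₁ lam i r).mul
        ((isResolventMatrix_resolventMatrix (continuous_slowMatrix ha₀ lam)).continuous_apply r j)
  choose N hN0 hN using hex
  -- By Jacobi's formula this is the derivative at δ = 0 of det(T₀ + δ N - μ).
  refine ⟨fun lam μ => ((resolventMatrix (slowMatrix a₀ lam) X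
    - μ • (1 : Matrix (Fin 3) (Fin 3) ℂ)).adjugate * N lam X).trace, fun Λ Ca hCa => ?_⟩
  obtain ⟨s, hs0, hs⟩ := exists_slow_bounds (X := X) ha₀ ha₁ Λ
  obtain ⟨C₁, hC₁0, hC₁⟩ := exists_monodromy_expansion hX ha₀ ha₁ Λ hCa
  obtain ⟨C₂, hC₂0, hC₂⟩ := exists_det_expansion_bound (s + 1)
  have hXm : X ∈ Icc 0 X := ⟨hX.le, le_rfl⟩
  set B := 2 * s + C₁ + 1 with hB
  have hB0 : 0 ≤ B := by positivity
  refine ⟨C₂ + Nat.factorial 4 * 4 * (B + C₁) ^ 3 * C₁, by positivity, fun lam hlam μ hμ => ?_⟩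
  set T₀ := resolventMatrix (slowMatrix a₀ lam) X
  set A := T₀ - μ • (1 : Matrix (Fin 3) (Fin 3) ℂ) with hA
  have one_le : ∀ {n : ℕ} (i j : Fin n), ‖(μ • (1 : Matrix (Fin n) (Fin n) ℂ)) i j‖ ≤ 1 := by
    intro n i j
    rw [Matrix.smul_apply, Matrix.one_apply]
    split_ifs <;> simp [hμ]
  have hTe : ∀ i j, ‖T₀ i j‖ ≤ s := fun i j =>
    (norm_le_pi_norm (fun i => T₀ i j) i).trans (hs lam hlam _ (hN0 lam) (hN lam) j X hXm).1
  have hNe : ∀ i j, ‖N lam X i j‖ ≤ s := fun i j =>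
    (norm_le_pi_norm (fun i => N lam X i j) i).trans (hs lam hlam _ (hN0 lam) (hN lam) j X hXm).2
  have hAe : ∀ i j, ‖A i j‖ ≤ s + 1 := fun i j => norm_sub_le_of_le (hTe i j) (one_le i j)
  obtain ⟨d1, d2⟩ := hC₂ A (N lam X) hAe (fun i j => (hNe i j).trans (by linarith))
  have hp : 0 ≤ Nat.factorial 4 * 4 * (B + C₁) ^ 3 * C₁ := by positivity
  refine ⟨d1.trans (by linarith), fun δ hδ a ha haexp => ?_⟩
  have hδ2 : δ ^ 2 ≤ 1 := pow_le_one₀ hδ.1.le hδ.2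
  obtain ⟨e1, e2, e3⟩ := hC₁ lam hlam _ (hN0 lam) (hN lam) δ hδ a ha haexp
  set T := resolventMatrix (fastSlowMatrix δ a lam) X
  have nδ : ‖(δ : ℂ)‖ = δ := by rw [Complex.norm_real, Real.norm_of_nonneg hδ.1.le]
  have hC₁δ : C₁ * δ ^ 2 ≤ C₁ := mul_le_of_le_one_right hC₁0 hδ2
  -- Q keeps the exact last row apart from its diagonal entry, replaces the last column by (0, 0, 0,
  -- -μ), and truncates the slow block at first order. It is O(δ²)-close to the true matrix and its
  -- determinant factors.
  set Q := bordered (A + (δ : ℂ) • N lam X) (fun j => T 3 j.castSucc) (-μ) with hQ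
  have hQe : ∀ i j, ‖Q i j‖ ≤ B := by
    intro i j
    refine Fin.lastCases (motive := fun i => ‖Q i j‖ ≤ B) ?_ (fun i => ?_) i <;>
    refine Fin.lastCases (motive := fun j => ‖Q _ j‖ ≤ B) ?_ (fun j => ?_) j
    · rw [hQ, bordered_last_last, norm_neg, hμ]; linarith
    · rw [hQ, bordered_last_castSucc]; linarith [e3 j.castSucc]
    · rw [hQ, bordered_castSucc_last, norm_zero]; exact hB0
    · rw [hQ, bordered_castSucc_castSucc, Matrix.add_apply, Matrix.smul_apply]
      refine (norm_add_le_of_le (hAe i j) (?_ : _ ≤ s)).trans (by linarith)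
      rw [norm_smul, nδ]
      exact (mul_le_of_le_one_left (norm_nonneg _) hδ.2).trans (hNe i j)
  have hdiff : ∀ i j, ‖(T - μ • (1 : Matrix (Fin 4) (Fin 4) ℂ)) i j - Q i j‖ ≤ C₁ * δ ^ 2 := by
    intro i j
    refine Fin.lastCases (motive := fun i => ‖(T - μ • (1 : Matrix (Fin 4) (Fin 4) ℂ)) i j
      - Q i j‖ ≤ C₁ * δ ^ 2) ?_ (fun i => ?_) i <;>
    refine Fin.lastCases (motive := fun j => ‖(T - μ • (1 : Matrix (Fin 4) (Fin 4) ℂ)) _ j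
      - Q _ j‖ ≤ C₁ * δ ^ 2) ?_ (fun j => ?_) j
    · rw [hQ, bordered_last_last]
      simpa using e2 3
    · rw [hQ, bordered_last_castSucc]
      have : (1 : Matrix (Fin 4) (Fin 4) ℂ) (Fin.last 3) j.castSucc = 0 :=
        Matrix.one_apply_ne (Fin.castSucc_ne_last j).symm
      simp only [Matrix.sub_apply, Matrix.smul_apply, this, smul_zero, sub_zero]
      rw [show (Fin.last 3 : Fin 4) = 3 from rfl, sub_self, norm_zero]
      positivity
    · rw [hQ, bordered_castSucc_last]
      have : (1 : Matrix (Fin 4) (Fin 4) ℂ) i.castSucc (Fin.last 3) = 0 :=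
        Matrix.one_apply_ne (Fin.castSucc_ne_last i)
      simp only [Matrix.sub_apply, Matrix.smul_apply, this, smul_zero, sub_zero]
      exact e2 i.castSucc
    · rw [hQ, bordered_castSucc_castSucc]
      have : (T - μ • (1 : Matrix (Fin 4) (Fin 4) ℂ)) i.castSucc j.castSucc
          - (A + (δ : ℂ) • N lam X) i j = T i.castSucc j.castSucc - T₀ i j - δ * N lam X i j := by
        simp [hA, Matrix.one_apply]
        ring
      rw [this]
      exact e1 i j
  have hTμe : ∀ i j, ‖(T - μ • (1 : Matrix (Fin 4) (Fin 4) ℂ)) i j‖ ≤ B + C₁ := by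
    intro i j
    have := norm_add_le_of_le (hdiff i j) (hQe i j)
    rw [sub_add_cancel] at this
    linarith
  have key := norm_det_sub_det_le (C := B + C₁) (by positivity) (by positivity) hTμe
    (fun i j => (hQe i j).trans (by linarith)) hdiff
  rw [hQ, det_bordered] at key
  have h2 := d2 δ (by rw [nδ]; exact hδ.2)
  rw [nδ] at h2
  calc _ = ‖((T - μ • (1 : Matrix (Fin 4) (Fin 4) ℂ)).det - -μ * (A + (δ : ℂ) • N lam X).det)
        + -μ * ((A + (δ : ℂ) • N lam X).det
          - (A.det + δ * (A.adjugate * N lam X).trace))‖ := by (congr 1; ring)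
    _ ≤ Nat.factorial 4 * 4 * (B + C₁) ^ 3 * (C₁ * δ ^ 2) + C₂ * δ ^ 2 := by
      refine norm_add_le_of_le (by exact_mod_cast key) ?_
      rw [norm_mul, norm_neg, hμ, one_mul]
      exact h2
    _ = _ := by ring

end Expansion

/-! ### Zeros of the Evans functions and eigenvalues of the Bloch operators -/

section Eigenvalues

open Set Matrix MeasureTheory

theorem hasDerivWithinAt_exp_mul (ξ : ℝ) {f : ℝ → ℂ} {f' : ℂ} {s : Set ℝ} {x : ℝ}
    (hf : HasDerivWithinAt f f' s x) :
    HasDerivWithinAt (fun y : ℝ => Complex.exp (Complex.I * ξ * y) * f y)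
      (Complex.exp (Complex.I * ξ * x) * (f' + Complex.I * ξ * f x)) s x := by
  have h := ((Complex.ofRealCLM.hasDerivAt (x := x)).const_mul (Complex.I * ξ)).cexp
  refine (h.hasDerivWithinAt.mul hf).congr_deriv ?_
  simp
  ring

theorem hasDerivAt_exp_mul (ξ : ℝ) {f : ℝ → ℂ} {f' : ℂ} {x : ℝ} (hf : HasDerivAt f f' x) :
    HasDerivAt (fun y : ℝ => Complex.exp (Complex.I * ξ * y) * f y)
      (Complex.exp (Complex.I * ξ * x) * (f' + Complex.I * ξ * f x)) x := by
  rw [← hasDerivWithinAt_univ] at *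
  exact hasDerivWithinAt_exp_mul ξ hf

theorem periodic_iteratedDeriv {E : Type*} [NormedAddCommGroup E] [NormedSpace ℝ E] {w : ℝ → E}
    {X : ℝ} (hw : Function.Periodic w X) (k : ℕ) : Function.Periodic (iteratedDeriv k w) X := by
  intro x
  have h := congrFun (iteratedDeriv_comp_add_const k w X) x
  have e : (fun z => w (z + X)) = w := funext hw
  rw [e] at h
  exact h.symm

theorem hasDerivAt_iteratedDeriv {w : ℝ → ℂ} {n : ℕ} (hw : ContDiff ℝ n w) {k : ℕ} (hk : k < n)
    (x : ℝ) : HasDerivAt (iteratedDeriv k w) (iteratedDeriv (k + 1) w x) x := by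
  rw [iteratedDeriv_succ]
  exact (hw.differentiable_iteratedDeriv k (by exact_mod_cast hk) x).hasDerivAt

/-- A primitive of an integrable function `g` is continuously differentiable from the right if `g`
agrees with a continuous function wherever it is the derivative. -/
theorem hasDerivWithinAt_of_primitive {F g G : ℝ → ℂ} {X : ℝ}
    (hg : IntervalIntegrable g volume 0 X) (hG : Continuous G)
    (hF : ∀ x ∈ Icc 0 X, F x = F 0 + ∫ t in (0 : ℝ)..x, g t)
    (hgG : ∀ᵐ x, x ∈ Ioo 0 X → HasDerivAt F (g x) x → g x = G x) {x : ℝ} (hx : x ∈ Ico 0 X) :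
    HasDerivWithinAt F (G x) (Ici x) x := by
  have hX : 0 ≤ X := hx.1.trans hx.2.le
  have hae : ∀ᵐ t, t ∈ Ioo 0 X → g t = G t := by
    filter_upwards [hgG, hg.ae_hasDerivAt_integral] with t h1 h2 ht
    refine h1 ht ?_
    have h3 := (h2 (by rw [uIcc_of_le hX]; exact ⟨ht.1.le, ht.2.le⟩) 0
      (by rw [uIcc_of_le hX]; exact ⟨le_rfl, hX⟩)).const_add (F 0)
    refine h3.congr_of_eventuallyEq ?_
    filter_upwards [Ioo_mem_nhds ht.1 ht.2] with y hy using hF y ⟨hy.1.le, hy.2.le⟩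
  have hFG : ∀ y ∈ Icc 0 X, F y = F 0 + ∫ t in (0 : ℝ)..y, G t := by
    intro y hy
    rw [hF y hy]
    congr 1
    refine intervalIntegral.integral_congr_ae ?_
    have hne : ∀ᵐ t : ℝ, t ≠ X := by simp [ae_iff, measure_singleton]
    filter_upwards [hae, hne] with t h1 h2 ht
    rw [uIoc_of_le hy.1] at ht
    exact h1 ⟨ht.1, lt_of_le_of_ne (ht.2.trans hy.2) h2⟩
  have hd : HasDerivAt (fun y => F 0 + ∫ t in (0 : ℝ)..y, G t) (G x) x :=
    (intervalIntegral.integral_hasDerivAt_right (hG.intervalIntegrable 0 x)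
      (hG.stronglyMeasurableAtFilter _ _) hG.continuousAt).const_add _
  refine hd.hasDerivWithinAt.congr_of_eventuallyEq ?_ (hFG x ⟨hx.1, hx.2.le⟩)
  filter_upwards [Ico_mem_nhdsGE hx.2] with y hy using hFG y ⟨hx.1.trans hy.1, hy.2.le⟩

theorem det_sub_smul_one_eq_zero {n : ℕ} {R : Matrix (Fin n) (Fin n) ℂ} {μ : ℂ} {z : Fin n → ℂ}
    (hz : z ≠ 0) (h : R.mulVec z = μ • z) :
    (R - μ • (1 : Matrix (Fin n) (Fin n) ℂ)).det = 0 :=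
  Matrix.exists_mulVec_eq_zero_iff.mp ⟨z, hz, by
    rw [Matrix.sub_mulVec, Matrix.smul_mulVec, Matrix.one_mulVec, h, sub_self]⟩

theorem exists_eigenvector_of_det_eq_zero {n : ℕ} {R : Matrix (Fin n) (Fin n) ℂ} {μ : ℂ}
    (h : (R - μ • (1 : Matrix (Fin n) (Fin n) ℂ)).det = 0) :
    ∃ z : Fin n → ℂ, z ≠ 0 ∧ R.mulVec z = μ • z := by
  obtain ⟨z, hz, hz'⟩ := Matrix.exists_mulVec_eq_zero_iff.mpr h
  rw [Matrix.sub_mulVec, Matrix.smul_mulVec, Matrix.one_mulVec, sub_eq_zero] at hz'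
  exact ⟨z, hz, hz'⟩

/-- The equation, valid almost everywhere, identifies the weak fourth derivative with a continuous
function, so v = exp(iξx) w is a solution of the first-order system on one period. Periodicity of w
makes its initial vector an eigenvector of the monodromy matrix for exp(iξX), and a zero initial
vector would give w = 0. -/
theorem evansKdVKS_eq_zero_of_isKdVKSBlochEigenvalue {δ c X : ℝ} {U : ℝ → ℝ} {ξ : ℝ} {lam : ℂ}
    (hδ : 0 < δ) (hX : 0 < X) (hU : ContDiff ℝ 1 U)
    (h : IsKdVKSBlochEigenvalue δ c X U ξ lam) : evansKdVKS δ c X U lam ξ = 0 := by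
  obtain ⟨w, ⟨hper, hw, g, hg, hgw⟩, hw0, heq⟩ := h
  have hU' : Continuous (deriv U) := hU.continuous_deriv le_rfl
  have hUc := hU.continuous
  have hUd : ∀ x, HasDerivAt (fun y => ((U y - c : ℝ) : ℂ)) ((deriv U x : ℝ) : ℂ) x := fun x =>
    (((hU.differentiable one_ne_zero) x).hasDerivAt.sub_const c).ofReal_comp
  have hδ' : (δ : ℂ) ≠ 0 := by exact_mod_cast hδ.ne'
  set κ : ℂ := Complex.I * ξ with hκ
  have d0 : ∀ x, HasDerivAt w (iteratedDeriv 1 w x) x := fun x => by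
    simpa using hasDerivAt_iteratedDeriv hw (k := 0) (by norm_num) x
  have d1 := hasDerivAt_iteratedDeriv hw (k := 1) (by norm_num)
  have d2 := hasDerivAt_iteratedDeriv hw (k := 2) (by norm_num)
  have c0 : Continuous w := hw.continuous
  have c1 := hw.continuous_iteratedDeriv 1 (by norm_num)
  have c2 := hw.continuous_iteratedDeriv 2 (by norm_num)
  have c3 := hw.continuous_iteratedDeriv 3 (by norm_num)
  set w1 := iteratedDeriv 1 w
  set w2 := iteratedDeriv 2 w
  set w3 := iteratedDeriv 3 w
  -- The Wₖ are chosen so that the k-th derivative of e w is e Wₖ.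
  let W1 : ℝ → ℂ := fun x => w1 x + κ * w x
  let W2 : ℝ → ℂ := fun x => w2 x + κ * w1 x + κ * W1 x
  let W3 : ℝ → ℂ := fun x => w3 x + κ * w2 x + κ * (w2 x + κ * w1 x) + κ * W2 x
  have D1 : ∀ x, HasDerivAt W1 (w2 x + κ * w1 x) x := fun x => (d1 x).add ((d0 x).const_mul κ)
  have D2 : ∀ x, HasDerivAt W2 (w3 x + κ * w2 x + κ * (w2 x + κ * w1 x)) x := fun x =>
    ((d2 x).add ((d1 x).const_mul κ)).add ((D1 x).const_mul κ)
  let e : ℝ → ℂ := fun x => Complex.exp (κ * x)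
  have he : ∀ x, e x ≠ 0 := fun x => Complex.exp_ne_zero _
  have ec : Continuous e := by fun_prop
  let v : ℝ → ℂ := fun x => e x * w x
  have hv0 : ∀ x, HasDerivAt v (e x * W1 x) x := fun x => hasDerivAt_exp_mul ξ (d0 x)
  have hv1 : ∀ x, HasDerivAt (fun x => e x * W1 x) (e x * W2 x) x := fun x =>
    hasDerivAt_exp_mul ξ (D1 x)
  have hv2 : ∀ x, HasDerivAt (fun x => e x * W2 x) (e x * W3 x) x := fun x =>
    hasDerivAt_exp_mul ξ (D2 x)
  have iv1 : iteratedDeriv 1 v = fun x => e x * W1 x := by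
    rw [iteratedDeriv_one]; exact funext fun x => (hv0 x).deriv
  have iv2 : iteratedDeriv 2 v = fun x => e x * W2 x := by
    rw [iteratedDeriv_succ, iv1]; exact funext fun x => (hv1 x).deriv
  have iv3 : iteratedDeriv 3 v = fun x => e x * W3 x := by
    rw [iteratedDeriv_succ, iv2]; exact funext fun x => (hv2 x).deriv
  have iv4 : iteratedDeriv 4 v = deriv fun x => e x * W3 x := by
    rw [iteratedDeriv_succ, iv3]
  let a : ℝ → ℂ := fun x => ((U x - c : ℝ) : ℂ)
  let a' : ℝ → ℂ := fun x => ((deriv U x : ℝ) : ℂ)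
  -- The equation L v = λ v, solved for the fourth derivative, reads v'''' = e H.
  let H : ℝ → ℂ := fun x => -((a' x + lam) * w x + a x * W1 x + W3 x + δ * W2 x) / δ
  have heq' : ∀ᵐ x : ℝ, deriv (fun x => e x * W3 x) x = e x * H x := by
    filter_upwards [heq] with x hx
    have hav : deriv (fun y => ((U y - c : ℝ) : ℂ) * v y) x = a' x * v x + a x * (e x * W1 x) :=
      ((hUd x).mul (hv0 x)).deriv
    have hx' : Complex.exp (-(κ * x)) * linearizedOp δ c U v x = lam * w x := hx
    simp only [linearizedOp, hav, iv2, iv3, iv4] at hx'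
    have hee : e x * Complex.exp (-(κ * x)) = 1 := by
      simp only [e]; rw [← Complex.exp_add]; simp
    have hx2 := congrArg (e x * ·) hx'
    simp only [← mul_assoc, hee, one_mul] at hx2
    simp only [H]
    field_simp
    simp only [v] at hx2
    linear_combination -hx2
  -- R3 is the part of W3' that does not involve the derivative of w3, so G is the value that the
  -- equation prescribes for that derivative; G depends on w, w1, w2, w3 only and is continuous.
  let R3 : ℝ → ℂ := fun x => κ * w3 x + κ * (w3 x + κ * w2 x)
    + κ * (w3 x + κ * w2 x + κ * (w2 x + κ * w1 x))
  let G : ℝ → ℂ := fun x => H x - κ * W3 x - R3 x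
  have D3 : ∀ (s : Set ℝ) (x : ℝ) (z : ℂ), HasDerivWithinAt w3 z s x →
      HasDerivWithinAt (fun x => e x * W3 x) (e x * (z + R3 x + κ * W3 x)) s x := by
    intro s x z hz
    have h := (((hz.add ((d2 x).const_mul κ).hasDerivWithinAt)).add
      (((d2 x).add ((d1 x).const_mul κ)).const_mul κ).hasDerivWithinAt).add
      ((D2 x).const_mul κ).hasDerivWithinAt
    refine (hasDerivWithinAt_exp_mul ξ (f := W3) h).congr_deriv ?_
    simp only [e, R3, hκ]
    ring
  have Gc : Continuous G := by
    simp only [G, H, R3, W3, W2, W1, a, a']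
    fun_prop
  have hgi : IntervalIntegrable g volume 0 X := by
    rw [intervalIntegrable_iff_integrableOn_Ioc_of_le hX.le]
    exact hg.integrable (by norm_num)
  -- Where w3 is not differentiable, `deriv` may be a default value, so the equation is used only at
  -- points where w3 has derivative g; almost every point of the period is one.
  have hw3 : ∀ x ∈ Ico 0 X, HasDerivWithinAt w3 (G x) (Ici x) x := fun x hx =>
    hasDerivWithinAt_of_primitive hgi Gc hgw (by
      filter_upwards [heq'] with y hy _ hd
      have := (D3 univ y (g y) hd.hasDerivWithinAt).hasDerivAt Filter.univ_mem
      rw [this.deriv] at hy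
      have := mul_left_cancel₀ (he y) hy
      simp only [G]
      linear_combination this) hx
  have hv3 : ∀ x ∈ Ico 0 X, HasDerivWithinAt (fun x => e x * W3 x) (e x * H x) (Ici x) x :=
    fun x hx => (D3 _ x _ (hw3 x hx)).congr_deriv (by simp only [G]; ring)
  let Z : ℝ → Fin 4 → ℂ := fun x => ![v x, e x * W1 x, e x * W2 x, e x * W3 x]
  have hA := continuous_kdvksMatrix hUc hU' δ c lam
  have hR := isResolventMatrix_resolventMatrix hA
  have hZ : ∀ x ∈ Icc 0 X, Z x = (resolventMatrix (kdvksMatrix δ c U lam) x).mulVec (Z 0) := by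
    intro x hx
    refine hR.eq_mulVec hA (X := X) (fun i => ?_) (fun i y hy => ?_) hx
    · refine Continuous.continuousOn ?_
      simp only [Z, v, W3, W2, W1]
      fin_cases i <;> simp <;> fun_prop
    · fin_cases i
      · simpa [Z, kdvksMatrix, Matrix.mulVec, dotProduct, Fin.sum_univ_four]
          using (hv0 y).hasDerivWithinAt
      · simpa [Z, kdvksMatrix, Matrix.mulVec, dotProduct, Fin.sum_univ_four]
          using (hv1 y).hasDerivWithinAt
      · simpa [Z, kdvksMatrix, Matrix.mulVec, dotProduct, Fin.sum_univ_four]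
          using (hv2 y).hasDerivWithinAt
      · refine (hv3 y hy).congr_deriv ?_
        simp [Z, kdvksMatrix, H, a, a', v]
        field_simp
        ring
  refine det_sub_smul_one_eq_zero (z := Z 0) (fun h0 => hw0 ?_) ?_
  · funext x
    obtain ⟨y, hy, hxy⟩ := hper.exists_mem_Ico₀ hX x
    have := hZ y ⟨hy.1, hy.2.le⟩
    rw [h0, Matrix.mulVec_zero] at this
    have h1 : e y * w y = 0 := congrFun this 0
    rw [hxy]
    simpa [he y] using h1
  · rw [← hZ X ⟨hX.le, le_rfl⟩]
    have p0 : w X = w 0 := by simpa using hper 0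
    have p1 : w1 X = w1 0 := by
      have := periodic_iteratedDeriv hper 1 0
      rwa [zero_add] at this
    have p2 : w2 X = w2 0 := by
      have := periodic_iteratedDeriv hper 2 0
      rwa [zero_add] at this
    have p3 : w3 X = w3 0 := by
      have := periodic_iteratedDeriv hper 3 0
      rwa [zero_add] at this
    funext i
    fin_cases i <;> simp [Z, v, e, W1, W2, W3, p0, p1, p2, p3, hκ]

/-- At a zero of the Evans function of linearized KdV there is a nontrivial Bloch wave. -/
theorem exists_blochWave_of_evansKdV_eq_zero {c X : ℝ} {U : ℝ → ℝ} {ξ : ℝ} {lam : ℂ}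
    (hU : ContDiff ℝ 1 U) (hper : Function.Periodic U X) (h : evansKdV c X U lam ξ = 0) :
    ∃ v v' v'' : ℝ → ℂ, (∀ x, HasDerivAt v (v' x) x) ∧ (∀ x, HasDerivAt v' (v'' x) x) ∧
      (∀ x, HasDerivAt v''
        (-(((deriv U x : ℝ) : ℂ) + lam) * v x - ((U x - c : ℝ) : ℂ) * v' x) x) ∧
      (∀ x, v (x + X) = Complex.exp (Complex.I * ξ * X) * v x) ∧
      (∀ x, v' (x + X) = Complex.exp (Complex.I * ξ * X) * v' x) ∧
      (∀ x, v'' (x + X) = Complex.exp (Complex.I * ξ * X) * v'' x) ∧ v ≠ 0 := by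
  have hA := continuous_kdvMatrix hU.continuous (hU.continuous_deriv le_rfl) c lam
  have hR := isResolventMatrix_resolventMatrix hA
  obtain ⟨z, hz, hz'⟩ := exists_eigenvector_of_det_eq_zero h
  set R := resolventMatrix (kdvMatrix c U lam)
  have hderper := iteratedDeriv_one (f := U) ▸ periodic_iteratedDeriv hper 1
  have hAper : Function.Periodic (kdvMatrix c U lam) X := fun x => by
    simp only [kdvMatrix, hper x, hderper x]
  have hB := hR.mulVec_add_period hA hAper hz'
  have d0 : ∀ x, HasDerivAt (fun y => (R y).mulVec z 0) ((R x).mulVec z 1) x := fun x =>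
    (hR.hasDerivAt_mulVec z 0 x).congr_deriv (by
      conv_lhs => rw [Matrix.mulVec]
      simp [kdvMatrix, dotProduct, Fin.sum_univ_three])
  have d1 : ∀ x, HasDerivAt (fun y => (R y).mulVec z 1) ((R x).mulVec z 2) x := fun x =>
    (hR.hasDerivAt_mulVec z 1 x).congr_deriv (by
      conv_lhs => rw [Matrix.mulVec]
      simp [kdvMatrix, dotProduct, Fin.sum_univ_three])
  refine ⟨fun x => (R x).mulVec z 0, fun x => (R x).mulVec z 1, fun x => (R x).mulVec z 2, d0, d1,
    fun x => (hR.hasDerivAt_mulVec z 2 x).congr_deriv ?_, fun x => congrFun (hB x) 0,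
    fun x => congrFun (hB x) 1, fun x => congrFun (hB x) 2, fun h0 => hz ?_⟩
  · conv_lhs => rw [Matrix.mulVec]
    simp [kdvMatrix, dotProduct, Fin.sum_univ_three]
    ring
  -- If v vanishes identically, so do v' and v'', hence the whole solution vector, including its
  -- initial value z.
  · have z0 : ∀ x, (R x).mulVec z 0 = 0 := fun x => congrFun h0 x
    have z1 : ∀ x, (R x).mulVec z 1 = 0 := fun x => by
      have := d0 x
      simp only [z0] at this
      exact this.unique (hasDerivAt_const x 0)
    have z2 : ∀ x, (R x).mulVec z 2 = 0 := fun x => by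
      have := d1 x
      simp only [z1] at this
      exact this.unique (hasDerivAt_const x 0)
    have hz0 : (R 0).mulVec z = z := by rw [hR.1, Matrix.one_mulVec]
    rw [← hz0]
    funext i
    fin_cases i
    · exact z0 0
    · exact z1 0
    · exact z2 0

theorem isKdVBlochEigenvalue_of_evansKdV_eq_zero {c X : ℝ} {U : ℝ → ℝ} {ξ : ℝ} {lam : ℂ}
    (hU : ContDiff ℝ 1 U) (hper : Function.Periodic U X)
    (h : evansKdV c X U lam ξ = 0) : IsKdVBlochEigenvalue c X U ξ lam := by
  obtain ⟨v, v', v'', d0, d1, d2, p0, -, -, hv⟩ :=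
    exists_blochWave_of_evansKdV_eq_zero hU hper h
  have hU' : Continuous (deriv U) := hU.continuous_deriv le_rfl
  have hUc := hU.continuous
  have hUd : ∀ x, HasDerivAt (fun y => ((U y - c : ℝ) : ℂ)) ((deriv U x : ℝ) : ℂ) x := fun x =>
    (((hU.differentiable one_ne_zero) x).hasDerivAt.sub_const c).ofReal_comp
  have c0 : Continuous v := continuous_iff_continuousAt.mpr fun x => (d0 x).continuousAt
  have c1 : Continuous v' := continuous_iff_continuousAt.mpr fun x => (d1 x).continuousAt
  have e0 : deriv v = v' := funext fun x => (d0 x).deriv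
  have e1 : deriv v' = v'' := funext fun x => (d1 x).deriv
  have e2 : deriv v'' = fun x => -(((deriv U x : ℝ) : ℂ) + lam) * v x
    - ((U x - c : ℝ) : ℂ) * v' x := funext fun x => (d2 x).deriv
  have C2 : ContDiff ℝ 1 v'' := contDiff_one_iff_deriv.mpr
    ⟨fun x => (d2 x).differentiableAt, by rw [e2]; fun_prop⟩
  have C1 : ContDiff ℝ 2 v' := by
    rw [show (2 : WithTop ℕ∞) = 1 + 1 from by norm_num, contDiff_succ_iff_deriv, e1]
    exact ⟨fun x => (d1 x).differentiableAt, by simp, C2⟩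
  have C0 : ContDiff ℝ 3 v := by
    rw [show (3 : WithTop ℕ∞) = 2 + 1 from by norm_num, contDiff_succ_iff_deriv, e0]
    exact ⟨fun x => (d0 x).differentiableAt, by simp, C1⟩
  let w : ℝ → ℂ := fun x => Complex.exp (-(Complex.I * ξ * x)) * v x
  have hw : ContDiff ℝ 3 w := by
    have : ContDiff ℝ 3 fun x : ℝ => Complex.exp (-(Complex.I * ξ * x)) :=
      (((contDiff_const (c := Complex.I * (ξ : ℂ))).mul Complex.ofRealCLM.contDiff).neg).cexp
    exact this.mul C0
  have hvw : (fun y : ℝ => Complex.exp (Complex.I * ξ * y) * w y) = v := by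
    funext y
    simp only [w]
    rw [← mul_assoc, ← Complex.exp_add]
    simp
  -- Since v is of class C³, the classical third derivative of w serves as the square integrable
  -- one, and the equation holds at every point.
  refine ⟨w, ⟨?_, hw.of_le (by norm_num), iteratedDeriv 3 w, ?_, ?_⟩, ?_, ?_⟩
  · intro x
    simp only [w, p0 x]
    rw [← mul_assoc, ← Complex.exp_add]
    congr 2
    push_cast
    ring
  · have hc3 : Continuous (iteratedDeriv 3 w) := hw.continuous_iteratedDeriv 3 le_rfl
    obtain ⟨B, hB⟩ := (isCompact_Icc (a := 0) (b := X)).exists_bound_of_continuousOn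
      hc3.continuousOn
    exact MemLp.of_bound hc3.aestronglyMeasurable B
      (ae_restrict_of_forall_mem measurableSet_Ioc fun x hx => hB x ⟨hx.1.le, hx.2⟩)
  · intro x _
    rw [intervalIntegral.integral_eq_sub_of_hasDerivAt
      (fun t _ => hasDerivAt_iteratedDeriv (n := 3) hw (k := 2) (by norm_num) t)
      ((hw.continuous_iteratedDeriv 3 le_rfl).intervalIntegrable _ _)]
    ring
  · intro h0
    refine hv ?_
    rw [← hvw, h0]
    funext y
    simp
  · refine Filter.Eventually.of_forall fun x => ?_
    have hav : deriv (fun y => ((U y - c : ℝ) : ℂ) * v y) x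
        = ((deriv U x : ℝ) : ℂ) * v x + ((U x - c : ℝ) : ℂ) * v' x := ((hUd x).mul (d0 x)).deriv
    have i3 : iteratedDeriv 3 v x
        = -(((deriv U x : ℝ) : ℂ) + lam) * v x - ((U x - c : ℝ) : ℂ) * v' x := by
      rw [iteratedDeriv_succ, iteratedDeriv_succ, iteratedDeriv_one, e0, e1, e2]
    rw [blochOp, hvw, linearizedOp, hav, i3]
    simp only [w]
    push_cast
    ring

/-- The spectrum of linearized KdV lies in a left half plane. -/
theorem evansKdV_ne_zero {c X : ℝ} {U : ℝ → ℝ} {ξ : ℝ} {lam : ℂ} (hX : 0 < X)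
    (hU : ContDiff ℝ 1 U) (hper : Function.Periodic U X)
    (hlam : ∀ x, 0 < deriv U x / 2 + lam.re) : evansKdV c X U lam ξ ≠ 0 := by
  intro h
  obtain ⟨v, v', v'', d0, d1, d2, p0, p1, p2, hv⟩ :=
    exists_blochWave_of_evansKdV_eq_zero hU hper h
  have hUd : ∀ x, HasDerivAt (fun y => U y - c) (deriv U x) x := fun x =>
    ((hU.differentiable one_ne_zero) x).hasDerivAt.sub_const c
  have re : ∀ {f : ℝ → ℂ} {f' : ℂ} {x : ℝ}, HasDerivAt f f' x →
      HasDerivAt (fun y => (f y).re) f'.re x := fun hf =>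
    Complex.reCLM.hasFDerivAt.comp_hasDerivAt _ hf
  have im : ∀ {f : ℝ → ℂ} {f' : ℂ} {x : ℝ}, HasDerivAt f f' x →
      HasDerivAt (fun y => (f y).im) f'.im x := fun hf =>
    Complex.imCLM.hasFDerivAt.comp_hasDerivAt _ hf
  -- Q = Re(v'' v̄) - |v'|²/2 + a |v|²/2 is the flux in the energy identity: taking the real part of
  -- the equation times v̄ gives Q' = -(U'/2 + Re λ) |v|². It is periodic because the Bloch
  -- multiplier has modulus one, and a monotone periodic function is constant.
  let Q : ℝ → ℝ := fun x => ((v'' x).re * (v x).re + (v'' x).im * (v x).im)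
    - ((v' x).re * (v' x).re + (v' x).im * (v' x).im) / 2
    + (U x - c) * ((v x).re * (v x).re + (v x).im * (v x).im) / 2
  have hQ : ∀ x, HasDerivAt Q (-((deriv U x / 2 + lam.re) * Complex.normSq (v x))) x := by
    intro x
    have h1 := ((((re (d2 x)).mul (re (d0 x))).add ((im (d2 x)).mul (im (d0 x)))).sub
      ((((re (d1 x)).mul (re (d1 x))).add ((im (d1 x)).mul (im (d1 x)))).div_const 2)).add
      (((hUd x).mul (((re (d0 x)).mul (re (d0 x))).add ((im (d0 x)).mul (im (d0 x))))).div_const 2)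
    refine h1.congr_deriv ?_
    simp [Complex.normSq_apply]
    ring
  have hanti : Antitone Q := antitone_of_hasDerivAt_nonpos hQ fun x =>
    neg_nonpos.mpr (mul_nonneg (hlam x).le (Complex.normSq_nonneg _))
  have hnorm : ∀ z w : ℂ, (Complex.exp (Complex.I * ξ * X) * z).re
      * (Complex.exp (Complex.I * ξ * X) * w).re + (Complex.exp (Complex.I * ξ * X) * z).im
      * (Complex.exp (Complex.I * ξ * X) * w).im = z.re * w.re + z.im * w.im := by
    intro z w
    have h1 : Complex.normSq (Complex.exp (Complex.I * ξ * X)) = 1 := by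
      rw [Complex.normSq_eq_norm_sq, show Complex.I * ξ * X = ((ξ * X : ℝ) : ℂ) * Complex.I by
        push_cast; ring, Complex.norm_exp_ofReal_mul_I]
      norm_num
    rw [Complex.normSq_apply] at h1
    set m := Complex.exp (Complex.I * ξ * X)
    simp only [Complex.mul_re, Complex.mul_im]
    linear_combination (z.re * w.re + z.im * w.im) * h1
  have hQper : ∀ x, Q (x + X) = Q x := by
    intro x
    simp only [Q, p0, p1, p2, hnorm, hper x]
  refine hv (funext fun x => ?_)
  have hconst : ∀ y ∈ Icc x (x + X), Q y = Q x := fun y hy =>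
    le_antisymm (hanti hy.1) ((hQper x).symm.le.trans (hanti hy.2))
  have hzero : HasDerivWithinAt Q 0 (Ici x) x := by
    refine (hasDerivWithinAt_const x (Ici x) (Q x)).congr_of_eventuallyEq ?_ rfl
    filter_upwards [Icc_mem_nhdsGE (show x < x + X by linarith)] with y hy using hconst y hy
  have := (uniqueDiffWithinAt_Ici x).eq_deriv _ (hQ x).hasDerivWithinAt hzero
  have h2 : Complex.normSq (v x) = 0 := by
    rcases mul_eq_zero.mp (neg_eq_zero.mp this) with h | h
    · exact absurd h (hlam x).ne'
    · exact h
  simpa using h2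

end Eigenvalues

/-! ### Isolated zeros and convergence of eigenvalues -/

section Convergence

open Set Matrix Filter Topology

theorem slowMatrix_add (a : ℝ → ℝ) (lam h : ℂ) (x : ℝ) : slowMatrix a (lam + h) x
    = slowMatrix a lam x + h • !![0, 0, 0; 0, 0, 0; -1, 0, 0] := by
  ext i j
  fin_cases i <;> fin_cases j <;> simp [slowMatrix]
  ring

theorem norm_matrix_corner_mulVec_le (v : Fin 3 → ℂ) :
    ‖(!![0, 0, 0; 0, 0, 0; -1, 0, 0] : Matrix (Fin 3) (Fin 3) ℂ).mulVecLin v‖ ≤ ‖v‖ := by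
  have h0 := norm_le_pi_norm v 0
  refine (pi_norm_le_iff_of_nonneg (norm_nonneg _)).mpr fun i => ?_
  fin_cases i <;> simp [dotProduct, Fin.sum_univ_three, h0]

/-- The resolvent matrix of the reduced system depends holomorphically on the spectral
parameter. -/
theorem differentiable_resolventMatrix_slowMatrix {X : ℝ} (hX : 0 ≤ X) {a : ℝ → ℝ}
    (ha : Continuous a) (i j : Fin 3) :
    Differentiable ℂ fun lam => resolventMatrix (slowMatrix a lam) X i j := by
  intro lam
  set J : Matrix (Fin 3) (Fin 3) ℂ := !![0, 0, 0; 0, 0, 0; -1, 0, 0] with hJ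
  have hT := fun lam => isResolventMatrix_resolventMatrix (continuous_slowMatrix ha lam)
  -- N solves the equation differentiated in λ, with J the λ-derivative of the coefficient matrix,
  -- and is the candidate derivative. Gronwall shows that the remainder is quadratic in h.
  obtain ⟨N, hN0, hN⟩ := exists_inhomogeneous_solution (continuous_slowMatrix ha lam)
    (G := fun x => J * resolventMatrix (slowMatrix a lam) x) fun i j => by
      simp only [Matrix.mul_apply]
      exact continuous_finsetSum _ fun r _ => continuous_const.mul ((hT lam).continuous_apply r j)
  have hNd : ∀ x, HasDerivAt (fun y i => N y i j) ((slowMatrix a lam x).mulVecLin (fun i => N x i j)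
      + J.mulVecLin fun i => resolventMatrix (slowMatrix a lam) x i j) x := fun x =>
    hasDerivAt_pi.mpr fun i => hN i j x
  have hNc : Continuous fun x => fun i => N x i j :=
    continuous_iff_continuousAt.mpr fun x => (hNd x).continuousAt
  obtain ⟨n, hn⟩ := (isCompact_Icc (a := 0) (b := X)).exists_bound_of_continuousOn
    hNc.continuousOn
  obtain ⟨m, hm⟩ := (isCompact_Icc (a := 0) (b := X)).exists_bound_of_continuousOn
    ha.continuousOn
  have hn0 : 0 ≤ n := (norm_nonneg _).trans (hn 0 ⟨le_rfl, hX⟩)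
  have hm0 : 0 ≤ m := (norm_nonneg _).trans (hm 0 ⟨le_rfl, hX⟩)
  set M := 1 + m + (‖lam‖ + 1) with hM
  have key : ∀ h : ℂ, ‖h‖ ≤ 1 → ‖resolventMatrix (slowMatrix a (lam + h)) X i j
      - resolventMatrix (slowMatrix a lam) X i j - h * N X i j‖
      ≤ (X * n * Real.exp (M * X)) * ‖h ^ 2‖ := by
    intro h hh
    have hD := norm_le_mul_exp_of_norm_deriv_le (X := X) (M := M)
      (D := fun x => (fun i => resolventMatrix (slowMatrix a (lam + h)) x i j)
        - (fun i => resolventMatrix (slowMatrix a lam) x i j) - h • fun i => N x i j)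
      (φ := fun _ => ‖h‖ ^ 2 * n) (F := X * (‖h‖ ^ 2 * n)) continuous_const (by positivity)
      (fun x => (((hT (lam + h)).hasDerivAt_col j x).sub ((hT lam).hasDerivAt_col j x)).sub
        ((hNd x).const_smul h)) (fun z hz => ?_) (fun y hy => ?_)
      (⟨hX, le_rfl⟩ : X ∈ Icc 0 X)
    · rw [(hT _).1, (hT _).1, hN0] at hD
      refine (norm_le_pi_norm (_ : Fin 3 → ℂ) i).trans (hD.trans_eq ?_)
      have : (fun i => (1 : Matrix (Fin 3) (Fin 3) ℂ) i j)
          - (fun i => (1 : Matrix (Fin 3) (Fin 3) ℂ) i j)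
          - h • (fun i => (0 : Matrix (Fin 3) (Fin 3) ℂ) i j) = 0 := by
        funext i; simp
      rw [this, norm_zero, norm_pow]
      ring
    · set S := fun i => resolventMatrix (slowMatrix a (lam + h)) z i j
      set S₀ := fun i => resolventMatrix (slowMatrix a lam) z i j
      set Nz := fun i => N z i j with hNz
      -- The coefficient matrix is affine in λ, so the only forcing of the error is h² J N.
      have e : (slowMatrix a (lam + h) z).mulVecLin S - (slowMatrix a lam z).mulVecLin S₀
          - h • ((slowMatrix a lam z).mulVecLin Nz + J.mulVecLin S₀)
          = (slowMatrix a (lam + h) z).mulVecLin (S - S₀ - h • Nz)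
            + (h ^ 2) • J.mulVecLin Nz := by
        simp only [Matrix.mulVecLin_apply, Matrix.mulVec_sub, Matrix.mulVec_smul, slowMatrix_add,
          ← hJ, Matrix.add_mulVec, Matrix.smul_mulVec]
        module
      rw [e]
      refine norm_add_le_of_le (norm_slowMatrix_mulVec_le ?_ _) ?_
      · have h1 := hm z hz
        rw [Real.norm_eq_abs] at h1
        linarith [norm_add_le lam h]
      · rw [norm_smul, norm_pow]
        exact mul_le_mul_of_nonneg_left ((norm_matrix_corner_mulVec_le _).trans (hn z hz))
          (by positivity)
    · rw [intervalIntegral.integral_const, smul_eq_mul, sub_zero]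
      exact mul_le_mul_of_nonneg_right hy.2 (by positivity)
  have hd : HasDerivAt (fun lam => resolventMatrix (slowMatrix a lam) X i j) (N X i j) lam := by
    rw [hasDerivAt_iff_isLittleO_nhds_zero]
    refine (Asymptotics.IsBigO.of_bound (X * n * Real.exp (M * X)) ?_).trans_isLittleO
      (Asymptotics.isLittleO_pow_id one_lt_two)
    filter_upwards [Metric.closedBall_mem_nhds (0 : ℂ) zero_lt_one] with h hh
    simpa using key h (by simpa using hh)
  exact hd.differentiableAt

theorem differentiable_evansKdV {c X : ℝ} {U : ℝ → ℝ} (hX : 0 ≤ X) (hU : ContDiff ℝ 1 U)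
    (hper : Function.Periodic U X) (ξ : ℝ) :
    Differentiable ℂ fun lam => evansKdV c X U lam ξ := by
  have hd := differentiable_resolventMatrix_slowMatrix hX
    (a := fun x => U x - c) (by have := hU.continuous; fun_prop)
  simp only [evansKdV_eq hU hper, Matrix.det_fin_three, Matrix.sub_apply]
  fun_prop

/-- Any real λ above sup |U'| is excluded by the energy identity; this rules out that the entire
function vanishes identically, which isolates its zeros. -/
theorem exists_evansKdV_ne_zero {c X : ℝ} {U : ℝ → ℝ} (hX : 0 < X) (hU : ContDiff ℝ 1 U)
    (hper : Function.Periodic U X) (ξ : ℝ) : ∃ lam, evansKdV c X U lam ξ ≠ 0 := by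
  obtain ⟨B, hB⟩ := (isCompact_Icc (a := 0) (b := X)).exists_bound_of_continuousOn
    (hU.continuous_deriv le_rfl).continuousOn
  have hderper := iteratedDeriv_one (f := U) ▸ periodic_iteratedDeriv hper 1
  have hB' : ∀ x, |deriv U x| ≤ B := fun x => by
    obtain ⟨y, hy, hxy⟩ := hderper.exists_mem_Ico₀ hX x
    rw [hxy]
    exact hB y ⟨hy.1, hy.2.le⟩
  refine ⟨((B + 1 : ℝ) : ℂ), evansKdV_ne_zero hX hU hper fun x => ?_⟩
  rw [Complex.ofReal_re]
  linarith [neg_abs_le (deriv U x), hB' x, abs_nonneg (deriv U x)]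

/-- The points of K at distance at least ε from every zero in K form a compact set on which |f| has
a positive minimum m. If that set is empty, any m works. -/
theorem exists_zero_near_of_norm_lt {f : ℂ → ℂ} (hf : Continuous f) {K : Set ℂ} (hK : IsCompact K)
    {ε : ℝ} (hε : 0 < ε) : ∃ m > 0, ∀ z ∈ K, ‖f z‖ < m → ∃ z₀ ∈ K, f z₀ = 0 ∧ ‖z - z₀‖ < ε := by
  let K' := K ∩ {z | ∀ z₀ ∈ K, f z₀ = 0 → ε ≤ ‖z - z₀‖}
  have hcl : IsClosed {z | ∀ z₀ ∈ K, f z₀ = 0 → ε ≤ ‖z - z₀‖} := by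
    simp only [ofPred_forall]
    exact isClosed_iInter fun z₀ => isClosed_iInter fun _ => isClosed_iInter fun _ =>
      isClosed_le continuous_const (by fun_prop)
  have hK' : IsCompact K' := hK.inter_right hcl
  have hne : ∀ z ∈ K', f z ≠ 0 := fun z hz h0 => by
    have := hz.2 z hz.1 h0
    simp at this
    linarith
  obtain ⟨m, hm, hmK⟩ : ∃ m > 0, ∀ z ∈ K', m ≤ ‖f z‖ := by
    rcases K'.eq_empty_or_nonempty with he | he
    · exact ⟨1, one_pos, by simp [he]⟩
    · obtain ⟨z, hz, hmin⟩ := hK'.exists_isMinOn he hf.norm.continuousOn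
      exact ⟨‖f z‖, norm_pos_iff.mpr (hne z hz), fun y hy => hmin hy⟩
  refine ⟨m, hm, fun z hz hzm => ?_⟩
  by_contra! hcon
  exact absurd (hmK z ⟨hz, fun z₀ h₀ h₀' => hcon z₀ h₀ h₀'⟩) (not_le.mpr hzm)

/-- A continuous path in a compact set along which a nonzero entire function tends to `0` converges
to a zero of that function. -/
theorem exists_tendsto_zero_of_tendsto {f : ℂ → ℂ} (hf : Differentiable ℂ f) (hf0 : ∃ z, f z ≠ 0)
    {K : Set ℂ} (hK : IsCompact K) {δ₁ : ℝ} (hδ₁ : 0 < δ₁) {g : ℝ → ℂ}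
    (hg : ContinuousOn g (Ioo 0 δ₁)) (hgK : ∀ δ ∈ Ioo 0 δ₁, g δ ∈ K)
    (hfg : Tendsto (fun δ => f (g δ)) (𝓝[>] 0) (𝓝 0)) :
    ∃ z₀ ∈ K, f z₀ = 0 ∧ Tendsto g (𝓝[>] 0) (𝓝 z₀) := by
  have hmem : Ioo 0 δ₁ ∈ 𝓝[>] (0 : ℝ) := Ioo_mem_nhdsGT hδ₁
  obtain ⟨z₀, hz₀K, hz₀⟩ := hK.exists_mapClusterPt (f := 𝓝[>] (0 : ℝ)) (u := g)
    (le_principal_iff.mpr (mem_map.mpr (mem_of_superset hmem hgK)))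
  have hfz₀ : f z₀ = 0 := by
    have h1 : MapClusterPt (f z₀) (𝓝[>] (0 : ℝ)) (f ∘ g) :=
      hz₀.continuousAt_comp hf.continuous.continuousAt
    by_contra hne
    have hpos : 0 < ‖f z₀‖ / 2 := by have := norm_pos_iff.mpr hne; positivity
    have h2 := (mapClusterPt_iff_frequently.mp h1) _ (Metric.ball_mem_nhds (f z₀) hpos)
    have h3 := hfg (Metric.ball_mem_nhds 0 hpos)
    obtain ⟨δ, hδ, hδ'⟩ := (h2.and_eventually h3).exists
    simp only [Metric.mem_ball, dist_eq_norm, sub_zero, Function.comp_apply] at hδ hδ'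
    have h4 : ‖f z₀‖ ≤ ‖f (g δ) - f z₀‖ + ‖f (g δ)‖ := by
      rw [norm_sub_rev]
      simpa using norm_add_le (f z₀ - f (g δ)) (f (g δ))
    linarith
  have hiso : ∀ᶠ z in 𝓝[≠] z₀, f z ≠ 0 := by
    have han : AnalyticOnNhd ℂ f univ := fun z _ => hf.analyticAt z
    rcases (han z₀ trivial).eventually_eq_zero_or_eventually_ne_zero with h | h
    · obtain ⟨z, hz⟩ := hf0
      exact absurd (han.eqOn_zero_of_preconnected_of_eventuallyEq_zero isPreconnected_univ
        (mem_univ z₀) h (mem_univ z)) hz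
    · exact h
  rw [eventually_nhdsWithin_iff, Metric.eventually_nhds_iff] at hiso
  obtain ⟨r, hr, hiso⟩ := hiso
  refine ⟨z₀, hz₀K, hfz₀, Metric.tendsto_nhds.mpr fun ε hε => ?_⟩
  -- Below r no other zero interferes, so |f| has a positive lower bound m on the circle of radius
  -- ρ; below ε, staying inside the circle is the desired estimate.
  set ρ := min ε r / 2 with hρ
  have hmin : 0 < min ε r := lt_min hε hr
  have hρ0 : 0 < ρ := by positivity
  have hρε : ρ < ε := by linarith [min_le_left ε r]
  have hρr : ρ < r := by linarith [min_le_right ε r]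
  obtain ⟨m, hm, hmS⟩ : ∃ m > 0, ∀ z ∈ Metric.sphere z₀ ρ, m ≤ ‖f z‖ := by
    obtain ⟨z, hz, hmin⟩ := (isCompact_sphere z₀ ρ).exists_isMinOn
      (NormedSpace.sphere_nonempty.mpr hρ0.le) hf.continuous.norm.continuousOn
    refine ⟨‖f z‖, norm_pos_iff.mpr (hiso (by rw [Metric.mem_sphere.mp hz]; exact hρr) ?_),
      fun y hy => hmin hy⟩
    rintro rfl
    simp at hz
    linarith
  have hsmall : ∀ᶠ δ in 𝓝[>] (0 : ℝ), ‖f (g δ)‖ < m := by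
    filter_upwards [hfg (Metric.ball_mem_nhds 0 hm)] with δ hδ
    simpa using hδ
  obtain ⟨δ₂, hδ₂, hsub⟩ := mem_nhdsGT_iff_exists_Ioo_subset.mp (inter_mem hmem hsmall)
  have hne : ∀ δ ∈ Ioo 0 δ₂, dist (g δ) z₀ ≠ ρ := fun δ hδ heq =>
    absurd (hmS (g δ) heq) (not_le.mpr (hsub hδ).2)
  have hcont : ContinuousOn (fun δ => dist (g δ) z₀) (Ioo 0 δ₂) :=
    (continuous_id.dist continuous_const).comp_continuousOn (hg.mono fun δ hδ => (hsub hδ).1)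
  -- The cluster point supplies one parameter in (0, δ₂) at which the path is inside the circle;
  -- leaving the ε-ball elsewhere in this interval would force a crossing, where |f| ≥ m contradicts
  -- |f| < m.
  obtain ⟨δ₃, h₃, hδ₃⟩ := (((mapClusterPt_iff_frequently.mp hz₀) _
    (Metric.ball_mem_nhds z₀ hρ0)).and_eventually (Ioo_mem_nhdsGT hδ₂)).exists
  filter_upwards [Ioo_mem_nhdsGT hδ₂] with δ hδ
  by_contra! hcon
  obtain ⟨δ', hδ', heq⟩ := isPreconnected_Ioo.intermediate_value hδ₃ hδ hcont
    (⟨(Metric.mem_ball.mp h₃).le, hρε.le.trans hcon⟩ : ρ ∈ Icc _ _)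
  exact hne δ' hδ' heq

end Convergence

/-! ### The Floquet factor, continuity of the first-order profile, and the main theorem. -/

theorem norm_exp_I_mul_mul (ξ X : ℝ) : ‖Complex.exp (Complex.I * ξ * X)‖ = 1 := by
  rw [show Complex.I * ξ * X = ((ξ * X : ℝ) : ℂ) * Complex.I by push_cast; ring,
    Complex.norm_exp_ofReal_mul_I]

theorem analyticAt_exp_I_mul_mul (X : ℝ) (p : ℂ × ℝ × ℝ) :
    AnalyticAt ℝ (fun p : ℂ × ℝ × ℝ => Complex.exp (Complex.I * p.2.1 * X)) p := by
  have h1 : AnalyticAt ℝ (fun p : ℂ × ℝ × ℝ => (p.2.1 : ℂ)) p :=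
    (Complex.ofRealCLM.comp ((ContinuousLinearMap.fst ℝ ℝ ℝ).comp
      (ContinuousLinearMap.snd ℝ ℂ (ℝ × ℝ)))).analyticAt p
  have h2 : AnalyticAt ℝ (fun p : ℂ × ℝ × ℝ => Complex.I * p.2.1 * X) p :=
    (analyticAt_const.mul h1).mul analyticAt_const
  exact (analyticAt_cexp.restrictScalars (𝕜 := ℝ)).comp h2

/-- In a family of profiles with a uniform first order expansion, the first order term is
continuous. -/
theorem continuous_of_uniform_expansion {δ₀ : ℝ} (hδ₀ : 0 < δ₀) {U : ℝ → ℝ → ℝ} {U₀ U₁ : ℝ → ℝ}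
    (hU : ∀ δ ∈ Set.Ioo 0 δ₀, Continuous (U δ)) (hU₀ : Continuous U₀) {C : ℝ}
    (hexp : ∀ δ ∈ Set.Ioo 0 δ₀, ∀ x, |U δ x - (U₀ x + δ * U₁ x)| ≤ C * δ ^ 2) :
    Continuous U₁ := by
  have hmem : Set.Ioo 0 δ₀ ∈ nhdsWithin (0 : ℝ) (Set.Ioi 0) := Ioo_mem_nhdsGT hδ₀
  have hlim : Filter.Tendsto (fun δ : ℝ => C * δ) (nhdsWithin 0 (Set.Ioi 0)) (nhds 0) := by
    have : Filter.Tendsto (fun δ : ℝ => C * δ) (nhds 0) (nhds (C * 0)) :=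
      (continuous_const.mul continuous_id).tendsto 0
    rw [mul_zero] at this
    exact this.mono_left nhdsWithin_le_nhds
  have hunif : TendstoUniformly (fun δ x => (U δ x - U₀ x) / δ) U₁
      (nhdsWithin 0 (Set.Ioi 0)) := by
    rw [Metric.tendstoUniformly_iff]
    intro ε hε
    filter_upwards [hmem, hlim (Iio_mem_nhds hε)] with δ hδ hδε x
    have h1 := hexp δ hδ x
    have e : U₁ x - (U δ x - U₀ x) / δ = -((U δ x - (U₀ x + δ * U₁ x)) / δ) := by
      have := hδ.1.ne'
      field_simp
      ring
    rw [Real.dist_eq, e, abs_neg, abs_div, abs_of_pos hδ.1, div_lt_iff₀ hδ.1]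
    have h2 : C * δ < ε := hδε
    nlinarith [mul_lt_mul_of_pos_right h2 hδ.1]
  refine hunif.continuous (Filter.Eventually.frequently ?_)
  filter_upwards [hmem] with δ hδ
  exact ((hU δ hδ).sub hU₀).div_const δ

theorem propositionp
    -- a family of periodic travelling waves of KdV-KS, with period independent of `δ`
    (X δ₀ : ℝ) (hX : 0 < X) (hδ₀ : 0 < δ₀)
    (U : ℝ → ℝ → ℝ) (c : ℝ → ℝ)
    (hU : ∀ δ ∈ Set.Ioo 0 δ₀, IsKdVKSWave δ (c δ) X (U δ))
    -- that bifurcates from a periodic travelling wave of KdV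
    (U₀ U₁ : ℝ → ℝ) (c₀ c₁ : ℝ)
    (hU₀ : IsKdVWave c₀ X U₀)
    (hUexp : ∃ C : ℝ, ∀ δ ∈ Set.Ioo 0 δ₀, ∀ x, |U δ x - (U₀ x + δ * U₁ x)| ≤ C * δ ^ 2)
    (hcexp : ∃ C : ℝ, ∀ δ ∈ Set.Ioo 0 δ₀, |c δ - (c₀ + δ * c₁)| ≤ C * δ ^ 2) :
    -- expansion of the Evans function up to a nonvanishing analytic factor `Γ`
    (∃ (Γ : ℂ → ℝ → ℝ → ℂ) (E₁ : ℂ → ℝ → ℂ),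
      (∀ lam ξ δ, 0 < δ → Γ lam ξ δ ≠ 0) ∧
      AnalyticOnNhd ℝ (fun p : ℂ × ℝ × ℝ => Γ p.1 p.2.1 p.2.2) {p | 0 < p.2.2} ∧
      (∀ ξ δ, 0 < δ → Differentiable ℂ fun lam => Γ lam ξ δ) ∧
      ∀ K : Set ℂ, IsCompact K → ∃ C : ℝ, ∃ δ₁ ∈ Set.Ioc 0 δ₀,
        ∀ δ ∈ Set.Ioo 0 δ₁, ∀ lam ∈ K, ∀ ξ : ℝ, ∃ r : ℂ, ‖r‖ ≤ C * δ ^ 2 ∧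
          evansKdVKS δ (c δ) X (U δ) lam ξ
            = Γ lam ξ δ * (evansKdV c₀ X U₀ lam ξ + δ * E₁ lam ξ + r)) ∧
    -- convergence of the eigenvalues of `L_ξ` in a compact set
    (∀ K : Set ℂ, IsCompact K → ∀ ξ ∈ Set.Ico (-(Real.pi / X)) (Real.pi / X),
      -- the eigenvalues in `K` approach the set of eigenvalues of linearized KdV,
      (∀ ε > 0, ∃ δ₁ ∈ Set.Ioc 0 δ₀, ∀ δ ∈ Set.Ioo 0 δ₁, ∀ lam ∈ K,
        IsKdVKSBlochEigenvalue δ (c δ) X (U δ) ξ lam →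
          ∃ lam₀ ∈ K, IsKdVBlochEigenvalue c₀ X U₀ ξ lam₀ ∧ ‖lam - lam₀‖ < ε) ∧
      -- and every branch of eigenvalues in `K` converges to one of them
      (∀ δ₁ ∈ Set.Ioc 0 δ₀, ∀ lam : ℝ → ℂ, ContinuousOn lam (Set.Ioo 0 δ₁) →
        (∀ δ ∈ Set.Ioo 0 δ₁, lam δ ∈ K ∧ IsKdVKSBlochEigenvalue δ (c δ) X (U δ) ξ (lam δ)) →
          ∃ lam₀ ∈ K, IsKdVBlochEigenvalue c₀ X U₀ ξ lam₀ ∧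
            Filter.Tendsto lam (nhdsWithin 0 (Set.Ioi 0)) (nhds lam₀))) := by
  obtain ⟨CU, hCU⟩ := hUexp
  obtain ⟨Cc, hCc⟩ := hcexp
  have hU₀1 : ContDiff ℝ 1 U₀ := hU₀.1.of_le (by norm_num)
  have hU1 : ∀ δ ∈ Set.Ioo 0 δ₀, ContDiff ℝ 1 (U δ) := fun δ hδ => (hU δ hδ).1.of_le (by norm_num)
  have hU₁ : Continuous U₁ := continuous_of_uniform_expansion hδ₀
    (fun δ hδ => (hU1 δ hδ).continuous) hU₀1.continuous hCU
  have haexp : ∀ δ ∈ Set.Ioo 0 δ₀, ∀ x ∈ Set.Icc 0 X,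
      |(U δ x - c δ) - (U₀ x - c₀) - δ * (U₁ x - c₁)| ≤ (|CU| + |Cc|) * δ ^ 2 := by
    intro δ hδ x _
    have h1 := hCU δ hδ x
    have h2 := hCc δ hδ
    have e : (U δ x - c δ) - (U₀ x - c₀) - δ * (U₁ x - c₁)
      = (U δ x - (U₀ x + δ * U₁ x)) - (c δ - (c₀ + δ * c₁)) := by ring
    rw [e]
    refine (abs_sub _ _).trans ?_
    nlinarith [mul_le_mul_of_nonneg_right (le_abs_self CU) (sq_nonneg δ),
      mul_le_mul_of_nonneg_right (le_abs_self Cc) (sq_nonneg δ)]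
  obtain ⟨E₁, hE₁⟩ := exists_evans_expansion hX (a₀ := fun x => U₀ x - c₀)
    (a₁ := fun x => U₁ x - c₁) (hU₀1.continuous.sub continuous_const) (hU₁.sub continuous_const)
  -- Both assertions rest on this estimate. Its uniformity in ξ comes from the fact that ξ enters
  -- only through a number of modulus one.
  have main : ∀ K : Set ℂ, IsCompact K → ∃ C : ℝ, 0 ≤ C ∧ ∀ δ ∈ Set.Ioo 0 (min δ₀ 1),
      ∀ lam ∈ K, ∀ ξ : ℝ, ‖E₁ lam (Complex.exp (Complex.I * ξ * X))‖ ≤ C ∧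
        ‖evansKdVKS δ (c δ) X (U δ) lam ξ - -Complex.exp (Complex.I * ξ * X)
          * (evansKdV c₀ X U₀ lam ξ + δ * E₁ lam (Complex.exp (Complex.I * ξ * X)))‖
          ≤ C * δ ^ 2 := by
    intro K hK
    obtain ⟨Λ, hΛ⟩ := hK.isBounded.exists_norm_le
    obtain ⟨C, hC0, hC⟩ := hE₁ Λ (|CU| + |Cc|) (by positivity)
    refine ⟨C, hC0, fun δ hδ lam hlam ξ => ?_⟩
    have hδ' : δ ∈ Set.Ioo 0 δ₀ := ⟨hδ.1, hδ.2.trans_le (min_le_left _ _)⟩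
    obtain ⟨h1, h2⟩ := hC lam (hΛ lam hlam) _ (norm_exp_I_mul_mul ξ X)
    refine ⟨h1, ?_⟩
    rw [evansKdVKS_eq hδ.1 (hU1 δ hδ') (hU δ hδ').2.1, evansKdV_eq hU₀1 hU₀.2.1]
    exact h2 δ ⟨hδ.1, hδ.2.le.trans (min_le_right _ _)⟩ (fun x => U δ x - c δ)
      ((hU1 δ hδ').continuous.sub continuous_const) (haexp δ hδ')
  have hmin : 0 < min δ₀ 1 := lt_min hδ₀ one_pos
  refine ⟨⟨fun _ ξ _ => -Complex.exp (Complex.I * ξ * X),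
    fun lam ξ => E₁ lam (Complex.exp (Complex.I * ξ * X)),
    fun _ _ _ _ => neg_ne_zero.mpr (Complex.exp_ne_zero _),
    fun p _ => (analyticAt_exp_I_mul_mul X p).neg,
    fun _ _ _ => differentiable_const _, fun K hK => ?_⟩, fun K hK ξ _ => ?_⟩
  · obtain ⟨C, -, hC⟩ := main K hK
    refine ⟨C, min δ₀ 1, ⟨hmin, min_le_left _ _⟩, fun δ hδ lam hlam ξ => ?_⟩
    set μ := Complex.exp (Complex.I * ξ * X) with hμ
    have hμ0 : μ ≠ 0 := Complex.exp_ne_zero _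
    have h := (hC δ hδ lam hlam ξ).2
    rw [← hμ] at h
    -- The remainder is the error divided by Γ = -μ, and |μ| = 1 preserves its bound.
    refine ⟨(evansKdVKS δ (c δ) X (U δ) lam ξ
      - -μ * (evansKdV c₀ X U₀ lam ξ + δ * E₁ lam μ)) / -μ, ?_, ?_⟩
    · rw [norm_div, norm_neg, hμ, norm_exp_I_mul_mul, div_one, ← hμ]
      exact h
    · field_simp
      ring
  · obtain ⟨C, hC0, hC⟩ := main K hK
    -- At an eigenvalue E = 0, so |E_kdv| ≤ δ |E₁| + C δ², and both terms are at most C δ.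
    have hsmall : ∀ δ ∈ Set.Ioo 0 (min δ₀ 1), ∀ lam ∈ K,
        IsKdVKSBlochEigenvalue δ (c δ) X (U δ) ξ lam →
          ‖evansKdV c₀ X U₀ lam ξ‖ ≤ 2 * C * δ := by
      intro δ hδ lam hlam heig
      have hδ' : δ ∈ Set.Ioo 0 δ₀ := ⟨hδ.1, hδ.2.trans_le (min_le_left _ _)⟩
      have hδ1 : δ ≤ 1 := hδ.2.le.trans (min_le_right _ _)
      obtain ⟨h1, h2⟩ := hC δ hδ lam hlam ξ
      rw [evansKdVKS_eq_zero_of_isKdVKSBlochEigenvalue hδ.1 hX (hU1 δ hδ') heig, zero_sub, norm_neg,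
        norm_mul, norm_neg, norm_exp_I_mul_mul, one_mul] at h2
      have h3 : ‖(δ : ℂ) * E₁ lam (Complex.exp (Complex.I * ξ * X))‖ ≤ δ * C := by
        rw [norm_mul, Complex.norm_real, Real.norm_of_nonneg hδ.1.le]
        exact mul_le_mul_of_nonneg_left h1 hδ.1.le
      have h4 := norm_sub_le_of_le h2 h3
      rw [add_sub_cancel_right] at h4
      have h5 : C * δ ^ 2 ≤ C * δ := mul_le_mul_of_nonneg_left (by nlinarith [hδ.1]) hC0
      linarith
    have hdiff := differentiable_evansKdV (c := c₀) hX.le hU₀1 hU₀.2.1 ξ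
    refine ⟨fun ε hε => ?_, fun δ₁ hδ₁ lam hcont hlam => ?_⟩
    · obtain ⟨m, hm, hmK⟩ := exists_zero_near_of_norm_lt hdiff.continuous hK hε
      -- The threshold makes 2 C δ < m; the added 1 keeps the denominator positive when C = 0.
      refine ⟨min (min δ₀ 1) (m / (2 * C + 1)), ⟨lt_min hmin (by positivity),
        (min_le_left _ _).trans (min_le_left _ _)⟩, fun δ hδ lam hlam heig => ?_⟩
      have h1 := hsmall δ ⟨hδ.1, hδ.2.trans_le (min_le_left _ _)⟩ lam hlam heig
      have h2 : δ * (2 * C + 1) < m :=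
        (lt_div_iff₀ (by positivity)).mp (hδ.2.trans_le (min_le_right _ _))
      obtain ⟨z₀, hz₀, hf, hlt⟩ := hmK lam hlam (by linarith [hδ.1])
      exact ⟨z₀, hz₀, isKdVBlochEigenvalue_of_evansKdV_eq_zero hU₀1 hU₀.2.1 hf, hlt⟩
    · obtain ⟨z₀, hz₀, hf, hlim⟩ := exists_tendsto_zero_of_tendsto hdiff
        (exists_evansKdV_ne_zero hX hU₀1 hU₀.2.1 ξ) hK hδ₁.1 hcont (fun δ hδ => (hlam δ hδ).1) (by
          have hlim0 : Filter.Tendsto (fun δ : ℝ => 2 * C * δ) (nhdsWithin 0 (Set.Ioi 0))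
              (nhds 0) := by
            have : Filter.Tendsto (fun δ : ℝ => 2 * C * δ) (nhds 0) (nhds (2 * C * 0)) :=
              (continuous_const.mul continuous_id).tendsto 0
            rw [mul_zero] at this
            exact this.mono_left nhdsWithin_le_nhds
          refine squeeze_zero_norm' ?_ hlim0
          filter_upwards [Ioo_mem_nhdsGT hδ₁.1, Ioo_mem_nhdsGT hmin] with δ h1 h2
          exact hsmall δ h2 (lam δ) (hlam δ h1).1 (hlam δ h1).2)
      exact ⟨z₀, hz₀, isKdVBlochEigenvalue_of_evansKdV_eq_zero hU₀1 hU₀.2.1 hf, hlim⟩
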